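/- Fix finite sets $\Xi$ (edge marks, totally ordered) and $\Theta$ (vertex marks). A *marked graph* is a simple, locally finite graph $G$ on a finite or countable vertex set in which every vertex $v$ carries a mark $\tau_G(v)\in\Theta$ and every edge $\{v,w\}$ carries two marks in $\Xi$, namely $\xi_G(v,w)$ towards $w$ and $\xi_G(w,v)$ towards $v$. Let $\bar{\mathcal G}_*$ be the set of isomorphism classes $[G,o]$ of marked graphs rooted at a vertex $o$ (only the connected component of $o$ matters), with the local metric $d_*=1/(1+h_*)$, where $h_*$ is the largest $h\ge 0$ such that the $h$-neighbourhoods of the two roots (the induced marked subgraphs on the vertices at distance at most $h$ from the root) are isomorphic as rooted marked graphs ($h_*=0$ if there is no such $h$, and $d_*=0$ if they are isomorphic for all $h$). Let $\bar{\mathcal G}_{**}$ be the analogous space of isomorphism classes $[G,o,v]$ of connected marked graphs with an ordered pair of (not necessarily distinct) distinguished vertices, with the analogous local topology. Both carry their Borel $\sigma$-algebras. Let $\mu$ be a Borel probability measure on $\bar{\mathcal G}_*$. It is *unimodular* if $$\int \sum_{v} f([G,o,v])\,d\mu([G,o])=\int \sum_{v} f([G,v,o])\,d\mu([G,o])$$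 for every measurable $f:\bar{\mathcal G}_{**}\to[0,\infty)$, the sums being over the vertices $v$ of the component of $o$. Let $\deg(\mu)$ be the expected degree of the root; let $\deg_{x,x'}(\mu)$, for $x,x'\in\Xi$, be the expected number of neighbours $v$ of the root $o$ with $\xi_G(v,o)=x$ and $\xi_G(o,v)=x'$; and let $\Pi_\theta(\mu)$, for $\theta\in\Theta$, be the probability that the root has mark $\theta$. Let $\vec d=(d_{x,x'})_{x,x'\in\Xi}$ be an average degree vector (nonnegative reals with $d_{x,x'}=d_{x',x}$ and $\sum_{x,x'}d_{x,x'}>0$), and let $Q=(q_\theta)_{\theta\in\Theta}$ be a probability distribution. For $n\geq 1$ let $\vec m^{(n)}=(m^{(n)}(x,x'))_{x,x'}$ be symmetric vectors of nonnegative integers and $\vec u^{(n)}=(u^{(n)}(\theta))_\theta$ vectors of nonnegative integers; put $\|\vec m^{(n)}\|_1=\sum_{x\le x'}m^{(n)}(x,x')$. Suppose that $(\vec m^{(n)},\vec u^{(n)})$ is *adapted to* $(\vec d,Q)$: for all $n$, $\|\vec m^{(n)}\|_1\le\binom n2$ and $\sum_\theta u^{(n)}(\theta)=n$; $m^{(n)}(x,x)/n\to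 d_{x,x}/2$ for all $x$; $m^{(n)}(x,x')/n\to d_{x,x'}$ for all $x\ne x'$; $u^{(n)}(\theta)/n\to q_\theta$ for all $\theta$; if $d_{x,x'}=0$ then $m^{(n)}(x,x')=0$ for all $n$; and if $q_\theta=0$ then $u^{(n)}(\theta)=0$ for all $n$. For $\epsilon>0$ let $\mathcal G^{(n)}(\mu,\epsilon)$ be the set of marked graphs $G$ on the vertex set $\{1,\dots,n\}$ that have, for all $x,x'\in\Xi$, exactly $m^{(n)}(x,x')$ edges whose two marks are $x$ and $x'$ (in some order), and, for all $\theta\in\Theta$, exactly $u^{(n)}(\theta)$ vertices with mark $\theta$, and for which the Lévy–Prokhorov distance between $U(G)=\frac1n\sum_{v}\delta_{[G,v]}$ and $\mu$ is less than $\epsilon$. With $\log 0=-\infty$, the *upper BC entropy* is $$\overline\Sigma_{\vec d,Q}(\mu)\big|_{(\vec m^{(n)},\vec u^{(n)})}=\lim_{\epsilon\downarrow0}\ \limsup_{n\to\infty}\frac{\log|\mathcal G^{(n)}(\mu,\epsilon)|-\|\vec m^{(n)}\|_1\log n}{n}.$$ **Proposition.** Assume $0<\deg(\mu)<\infty$.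 If $\mu$ is not unimodular, or $d_{x,x'}\ne\deg_{x,x'}(\mu)$ for some $x,x'\in\Xi$, or $q_\theta\neq\Pi_\theta(\mu)$ for some $\theta\in\Theta$, then for every sequence $(\vec m^{(n)},\vec u^{(n)})$ adapted to $(\vec d,Q)$, $$\overline\Sigma_{\vec d,Q}(\mu)\big|_{(\vec m^{(n)},\vec u^{(n)})}=-\infty .$$ -/

import Mathlib

open MeasureTheory Filter Topology Set
open scoped NNReal ENNReal

noncomputable section

/-- A simple, locally finite marked graph on the vertex set `V`, with edge marks in `Ξ` and vertex
marks in `Θ`. Every edge carries two marks, one towards each endpoint: `edgeMark v w = some x` says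
that `v` and `w` are adjacent and that `x` is the mark `ξ_G(v, w)` of the edge towards `w`;
`edgeMark v w = none` says that `v` and `w` are not adjacent. -/
@[ext]
structure MarkedGraph (V Ξ Θ : Type*) where
  graph : SimpleGraph V
  edgeMark : V → V → Option Ξ
  vertexMark : V → Θ
  isSome_edgeMark_iff : ∀ v w, (edgeMark v w).isSome ↔ graph.Adj v w
  locallyFinite : ∀ v, {w | graph.Adj v w}.Finite

namespace MarkedGraph

variable {V W X Ξ Θ : Type*}

/-- `deg_G^{x,x'}(o)`: the number of neighbours `v` of `o` with `ξ_G(v,o) = x` and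
`ξ_G(o,v) = x'`. -/
def markDegree (G : MarkedGraph V Ξ Θ) (x x' : Ξ) (o : V) : ℕ :=
  {v | G.edgeMark v o = some x ∧ G.edgeMark o v = some x'}.ncard

/-- `deg_G(o)`: the number of neighbours of `o`. -/
def degree (G : MarkedGraph V Ξ Θ) (o : V) : ℕ := {v | G.graph.Adj o v}.ncard

/-- `m_G(x,x')`: the number of edges whose two marks are `x` and `x'`, in some order. -/
def edgeMarkCount (G : MarkedGraph V Ξ Θ) (x x' : Ξ) : ℕ :=
  {e : Sym2 V | ∃ v w, e = s(v, w) ∧ G.edgeMark v w = some x ∧ G.edgeMark w v = some x'}.ncard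

/-- `u_G(θ)`: the number of vertices with mark `θ`. -/
def vertexMarkCount (G : MarkedGraph V Ξ Θ) (θ : Θ) : ℕ := {v | G.vertexMark v = θ}.ncard

/-- The marked subgraph induced on a set `S` of vertices. -/
def induce (G : MarkedGraph V Ξ Θ) (S : Set V) : MarkedGraph S Ξ Θ where
  graph := G.graph.induce S
  edgeMark v w := G.edgeMark v w
  vertexMark v := G.vertexMark v
  isSome_edgeMark_iff v w := by
    rw [G.isSome_edgeMark_iff]; rfl
  locallyFinite v := by
    have h := (G.locallyFinite v).preimage (f := ((↑) : S → V)) Subtype.val_injective.injOn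
    exact h

/-- Isomorphism of marked graphs with distinguished vertices: a bijection of the vertex sets that
preserves the distinguished vertices, the edge marks (hence also adjacency and non-adjacency) and
the vertex marks. -/
def RootedIso {k : ℕ} (G : MarkedGraph V Ξ Θ) (r : Fin k → V)
    (H : MarkedGraph W Ξ Θ) (s : Fin k → W) : Prop :=
  ∃ e : V ≃ W, (∀ i, e (r i) = s i) ∧
    (∀ v w, H.edgeMark (e v) (e w) = G.edgeMark v w) ∧
    ∀ v, H.vertexMark (e v) = G.vertexMark v

theorem RootedIso.refl {k : ℕ} (G : MarkedGraph V Ξ Θ) (r : Fin k → V) :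
    RootedIso G r G r :=
  ⟨Equiv.refl _, fun _ => rfl, fun _ _ => rfl, fun _ => rfl⟩

theorem RootedIso.symm {k : ℕ} {G : MarkedGraph V Ξ Θ} {r : Fin k → V}
    {H : MarkedGraph W Ξ Θ} {s : Fin k → W} (h : RootedIso G r H s) : RootedIso H s G r := by
  obtain ⟨e, h1, h2, h3⟩ := h
  refine ⟨e.symm, fun i => by simp [← h1], fun v w => ?_, fun v => ?_⟩
  · simpa using (h2 (e.symm v) (e.symm w)).symm
  · simpa using (h3 (e.symm v)).symm

theorem RootedIso.trans {k : ℕ} {G : MarkedGraph V Ξ Θ} {r : Fin k → V}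
    {H : MarkedGraph W Ξ Θ} {s : Fin k → W} {K : MarkedGraph X Ξ Θ} {t : Fin k → X}
    (h : RootedIso G r H s) (h' : RootedIso H s K t) : RootedIso G r K t := by
  obtain ⟨e, h1, h2, h3⟩ := h
  obtain ⟨e', h1', h2', h3'⟩ := h'
  exact ⟨e.trans e', fun i => by simp [h1, h1'], fun v w => by simp [h2, h2'],
    fun v => by simp [h3, h3']⟩

/-- There are finitely many marked graphs on a finite vertex set with finite mark sets. -/
instance [Finite V] [Finite Ξ] [Finite Θ] : Finite (MarkedGraph V Ξ Θ) := by
  refine Finite.of_injective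
    (fun G => ((G.edgeMark, G.vertexMark) : (V → V → Option Ξ) × (V → Θ))) ?_
  intro G H h
  simp only [Prod.mk.injEq] at h
  refine MarkedGraph.ext ?_ h.1 h.2
  ext v w
  rw [← G.isSome_edgeMark_iff, ← H.isSome_edgeMark_iff, h.1]

end MarkedGraph

/-- A connected locally finite marked graph on a finite or countably infinite vertex set, with an
ordered tuple of `k` distinguished (not necessarily distinct) vertices. -/
structure RootedMarkedGraph (Ξ Θ : Type*) (k : ℕ) where
  V : Type
  countable : Countable V
  G : MarkedGraph V Ξ Θ
  connected : G.graph.Connected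
  root : Fin k → V

namespace RootedMarkedGraph

variable {Ξ Θ : Type*} {k : ℕ}

/-- Isomorphism of connected marked graphs with distinguished vertices. -/
def Iso (a b : RootedMarkedGraph Ξ Θ k) : Prop := a.G.RootedIso a.root b.G b.root

instance setoid (Ξ Θ : Type*) (k : ℕ) : Setoid (RootedMarkedGraph Ξ Θ k) where
  r := Iso
  iseqv := ⟨fun a => .refl a.G a.root, fun h => h.symm, fun h h' => h.trans h'⟩

/-- The vertices at distance at most `h` from (one of) the distinguished vertices. -/
def ball (a : RootedMarkedGraph Ξ Θ k) (h : ℕ) : Set a.V :=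
  {v | ∃ i, a.G.graph.dist (a.root i) v ≤ h}

theorem root_mem_ball (a : RootedMarkedGraph Ξ Θ k) (h : ℕ) (i : Fin k) : a.root i ∈ a.ball h :=
  ⟨i, by simp⟩

/-- `(G,o)_h ≡ (G',o')_h`: the subgraphs induced on the vertices at distance at most `h` from the
distinguished vertices are isomorphic. -/
def BallIso (h : ℕ) (a b : RootedMarkedGraph Ξ Θ k) : Prop :=
  (a.G.induce (a.ball h)).RootedIso (fun i => ⟨a.root i, a.root_mem_ball h i⟩)
    (b.G.induce (b.ball h)) (fun i => ⟨b.root i, b.root_mem_ball h i⟩)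

theorem ball_mono (a : RootedMarkedGraph Ξ Θ k) {m n : ℕ} (h : m ≤ n) : a.ball m ⊆ a.ball n :=
  fun _ ⟨i, hi⟩ => ⟨i, hi.trans h⟩

theorem mem_ball_map {a b : RootedMarkedGraph Ξ Θ k} {S : Set a.V} {T : Set b.V}
    (f : S → T) (hr : ∀ i (hi : a.root i ∈ S), (f ⟨a.root i, hi⟩ : b.V) = b.root i)
    (hf : ∀ v w : S, a.G.graph.Adj v w → b.G.graph.Adj (f v) (f w))
    (n : ℕ) (hn : a.ball n ⊆ S) (v : a.V) (hv : v ∈ a.ball n) :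
    (f ⟨v, hn hv⟩ : b.V) ∈ b.ball n := by
  induction n generalizing v with
  | zero =>
    obtain ⟨i, hi⟩ := hv
    have : a.root i = v := by
      rcases SimpleGraph.dist_eq_zero_iff_eq_or_not_reachable.1 (Nat.le_zero.1 hi) with h | h
      · exact h
      · exact absurd (a.connected _ _) h
    subst this
    exact ⟨i, by rw [hr]; simp⟩
  | succ n ih =>
    obtain ⟨i, hi⟩ := id hv
    obtain ⟨p, hp⟩ := a.connected.exists_walk_length_eq_dist v (a.root i)
    rw [SimpleGraph.dist_comm, ← hp] at hi
    cases p with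
    | nil => exact ⟨i, by rw [hr]; simp⟩
    | @cons _ u _ huv q =>
      have hu : u ∈ a.ball n := by
        refine ⟨i, ?_⟩
        rw [SimpleGraph.dist_comm]
        have := SimpleGraph.dist_le q
        simp only [SimpleGraph.Walk.length_cons] at hi
        omega
      obtain ⟨j, hj⟩ := ih ((a.ball_mono n.le_succ).trans hn) u hu
      refine ⟨j, ?_⟩
      have h1 := hf ⟨v, hn hv⟩ ⟨u, hn (a.ball_mono n.le_succ hu)⟩ huv
      have h2 := b.connected.dist_triangle (u := b.root j)
        (v := f ⟨u, hn (a.ball_mono n.le_succ hu)⟩) (w := f ⟨v, hn hv⟩)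
      have h3 := SimpleGraph.dist_eq_one_iff_adj.2 h1.symm
      omega

theorem ballIso_of_induce {a b : RootedMarkedGraph Ξ Θ k} {S : Set a.V} {T : Set b.V} {n : ℕ}
    (hS : a.ball n ⊆ S) (hT : b.ball n ⊆ T)
    (h : (a.G.induce S).RootedIso (fun i => ⟨a.root i, hS (a.root_mem_ball n i)⟩)
      (b.G.induce T) (fun i => ⟨b.root i, hT (b.root_mem_ball n i)⟩)) : BallIso n a b := by
  obtain ⟨e, h1, h2, h3⟩ := h
  have hadj : ∀ v w : S, b.G.graph.Adj (e v) (e w) ↔ a.G.graph.Adj v w := fun v w => by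
    rw [← b.G.isSome_edgeMark_iff, ← a.G.isSome_edgeMark_iff]
    have : b.G.edgeMark (e v) (e w) = a.G.edgeMark v w := h2 v w
    rw [this]
  have hfwd := mem_ball_map (a := a) (b := b) e
    (fun i _ => congrArg Subtype.val (h1 i)) (fun v w => (hadj v w).2) n hS
  have hbwd := mem_ball_map (a := b) (b := a) e.symm
    (fun i _ => by
      have : e.symm _ = _ := (Equiv.symm_apply_eq e).2 (h1 i).symm
      exact congrArg Subtype.val this)
    (fun v w hvw => by
      rw [← hadj]; simpa using hvw) n hT
  refine ⟨⟨fun v => ⟨_, hfwd v v.2⟩, fun v => ⟨_, hbwd v v.2⟩, fun v => ?_, fun v => ?_⟩,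
    fun i => ?_, fun v w => h2 _ _, fun v => h3 _⟩
  · simp
  · simp
  · have h4 : ((e ⟨a.root i, hS (a.root_mem_ball n i)⟩ : T) : b.V) = b.root i :=
      congrArg Subtype.val (h1 i)
    exact Subtype.ext h4

theorem BallIso.mono {a b : RootedMarkedGraph Ξ Θ k} {m n : ℕ} (hmn : m ≤ n)
    (h : BallIso n a b) : BallIso m a b :=
  ballIso_of_induce (a.ball_mono hmn) (b.ball_mono hmn) h

theorem Iso.ballIso {a b : RootedMarkedGraph Ξ Θ k} (h : Iso a b) (n : ℕ) : BallIso n a b := by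
  refine ballIso_of_induce (S := univ) (T := univ) (subset_univ _) (subset_univ _) ?_
  obtain ⟨e, h1, h2, h3⟩ := h
  refine ⟨(Equiv.Set.univ _).trans (e.trans (Equiv.Set.univ _).symm), fun i => ?_,
    fun v w => h2 _ _, fun v => h3 _⟩
  exact Subtype.ext (h1 i)

open Classical in
/-- The local distance: `0` if the `h`-neighbourhoods are isomorphic for all `h`, and
`1 / (1 + h_*)` otherwise, where `h_*` is the largest `h` for which they are isomorphic
(`h_* = 0` if there is none, that is, if the `0`-neighbourhoods already differ). -/
def localDist (a b : RootedMarkedGraph Ξ Θ k) : ℝ :=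
  if ∀ h, BallIso h a b then 0 else 1 / (1 + (sSup {h : ℕ | BallIso h a b} : ℕ))

theorem localDist_congr {a b a' b' : RootedMarkedGraph Ξ Θ k} (ha : Iso a a') (hb : Iso b b') :
    localDist a b = localDist a' b' := by
  have : ∀ h, BallIso h a b ↔ BallIso h a' b' := fun h =>
    ⟨fun H => (ha.ballIso h).symm.trans (H.trans (hb.ballIso h)),
      fun H => (ha.ballIso h).trans (H.trans (hb.ballIso h).symm)⟩
  have : (fun h => BallIso h a b) = fun h => BallIso h a' b' := funext fun h => propext (this h)
  unfold localDist
  congr 1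
  · exact congrArg (fun p : ℕ → Prop => ∀ h, p h) this
  · exact congrArg (fun p : ℕ → Prop => (1 / (1 + (sSup {h : ℕ | p h} : ℕ)) : ℝ)) this

theorem localDist_self (a : RootedMarkedGraph Ξ Θ k) : localDist a a = 0 :=
  if_pos fun _ => MarkedGraph.RootedIso.refl _ _

theorem localDist_comm (a b : RootedMarkedGraph Ξ Θ k) : localDist a b = localDist b a := by
  have : ∀ h, BallIso h a b ↔ BallIso h b a := fun h => ⟨fun H => H.symm, fun H => H.symm⟩
  have : (fun h => BallIso h a b) = fun h => BallIso h b a := funext fun h => propext (this h)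
  unfold localDist
  congr 1
  · exact congrArg (fun p : ℕ → Prop => ∀ h, p h) this
  · exact congrArg (fun p : ℕ → Prop => (1 / (1 + (sSup {h : ℕ | p h} : ℕ)) : ℝ)) this

theorem localDist_nonneg (a b : RootedMarkedGraph Ξ Θ k) : 0 ≤ localDist a b := by
  unfold localDist; split_ifs <;> positivity

theorem le_localDist {a b : RootedMarkedGraph Ξ Θ k} {n : ℕ} (h : ¬ BallIso (n + 1) a b) :
    1 / (1 + (n : ℝ)) ≤ localDist a b := by
  unfold localDist
  rw [if_neg fun H => h (H _)]
  have : sSup {h : ℕ | BallIso h a b} ≤ n := csSup_le' fun m hm => by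
    by_contra hlt
    exact h (BallIso.mono (by omega) hm)
  gcongr

theorem localDist_triangle (a b c : RootedMarkedGraph Ξ Θ k) :
    localDist a c ≤ localDist a b + localDist b c := by
  have h1 := localDist_nonneg a b
  have h2 := localDist_nonneg b c
  by_cases h : ∀ h, BallIso h a c
  · rw [localDist, if_pos h]; linarith
  · have hac : localDist a c = 1 / (1 + ((sSup {h : ℕ | BallIso h a c} : ℕ) : ℝ)) := if_neg h
    obtain ⟨m, hm⟩ := not_forall.1 h
    have hbdd : BddAbove {h : ℕ | BallIso h a c} := ⟨m, fun j hj => by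
      by_contra hlt
      exact hm (BallIso.mono (by omega) hj)⟩
    have hN : ¬ BallIso (sSup {h : ℕ | BallIso h a c} + 1) a c := fun H => by
      have := le_csSup hbdd H
      omega
    by_cases hab : BallIso (sSup {h : ℕ | BallIso h a c} + 1) a b
    · have hbc : ¬ BallIso (sSup {h : ℕ | BallIso h a c} + 1) b c := fun H => hN (hab.trans H)
      have := le_localDist hbc
      linarith
    · have := le_localDist hab
      linarith

end RootedMarkedGraph

/-- The set of isomorphism classes of connected marked graphs with `k` distinguished vertices. -/
def RootedClass (Ξ Θ : Type*) (k : ℕ) := Quotient (RootedMarkedGraph.setoid Ξ Θ k)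

namespace RootedClass

variable {Ξ Θ : Type*} {k : ℕ}

/-- The local (pseudo)metric `d_*`. -/
instance : PseudoMetricSpace (RootedClass Ξ Θ k) where
  dist := Quotient.lift₂ RootedMarkedGraph.localDist
    fun _ _ _ _ ha hb => RootedMarkedGraph.localDist_congr ha hb
  dist_self := by rintro ⟨a⟩; exact a.localDist_self
  dist_comm := by rintro ⟨a⟩ ⟨b⟩; exact a.localDist_comm b
  dist_triangle := by rintro ⟨a⟩ ⟨b⟩ ⟨c⟩; exact a.localDist_triangle b c

instance : MeasurableSpace (RootedClass Ξ Θ k) := borel _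

instance : BorelSpace (RootedClass Ξ Θ k) := ⟨rfl⟩

end RootedClass

/-- The space of isomorphism classes `[G, o]` of rooted marked graphs. -/
abbrev GStar (Ξ Θ : Type*) := RootedClass Ξ Θ 1

/-- The space of isomorphism classes `[G, o, v]` of connected marked graphs with an ordered pair of
distinguished vertices. -/
abbrev GStarStar (Ξ Θ : Type*) := RootedClass Ξ Θ 2

namespace MarkedGraph

variable {Ξ Θ : Type*}

/-- `[G, o]`: the isomorphism class of the connected component of `o` in `G`, rooted at `o`. -/
def rootedClass {V : Type} [Countable V] (G : MarkedGraph V Ξ Θ) (o : V) : GStar Ξ Θ :=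
  Quotient.mk _
    { V := {v | G.graph.Reachable o v}
      countable := inferInstance
      G := G.induce {v | G.graph.Reachable o v}
      connected := by
        have h := (G.graph.connectedComponentMk o).connected_toSimpleGraph
        have hs : (G.graph.connectedComponentMk o).supp = {v | G.graph.Reachable o v} := by
          ext v
          simp only [SimpleGraph.ConnectedComponent.mem_supp_iff,
            SimpleGraph.ConnectedComponent.eq, mem_ofPred_eq]
          exact ⟨fun h => h.symm, fun h => h.symm⟩
        exact hs ▸ h
      root := fun _ => ⟨o, SimpleGraph.Reachable.refl o⟩ }

/-- `U(G)`: the law of `[G, v]` for a uniformly random vertex `v` of the finite graph `G`. -/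
def neighborhoodLaw {V : Type} [Fintype V] (G : MarkedGraph V Ξ Θ) : Measure (GStar Ξ Θ) :=
  (Fintype.card V : ℝ≥0∞)⁻¹ • ∑ v, Measure.dirac (G.rootedClass v)

theorem ncard_eq_of_equiv {V W : Type*} (e : V ≃ W) {S : Set V} {T : Set W}
    (h : ∀ v, e v ∈ T ↔ v ∈ S) : S.ncard = T.ncard := by
  have : T = e '' S := by
    ext w
    constructor
    · intro hw
      exact ⟨e.symm w, (h _).1 (by simpa using hw), by simp⟩
    · rintro ⟨v, hv, rfl⟩
      exact (h v).2 hv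
  rw [this, ncard_image_of_injective _ e.injective]

end MarkedGraph

namespace GStar

variable {Ξ Θ : Type*}

/-- `deg_G^{x,x'}(o)` as a function of `[G, o]`. -/
def markDegree (x x' : Ξ) : GStar Ξ Θ → ℕ :=
  Quotient.lift (fun a : RootedMarkedGraph Ξ Θ 1 => a.G.markDegree x x' (a.root 0)) (by
    rintro a b ⟨e, h1, h2, -⟩
    refine MarkedGraph.ncard_eq_of_equiv e fun v => ?_
    simp only [mem_ofPred_eq]
    rw [← h1 0, h2, h2])

/-- `deg_G(o)` as a function of `[G, o]`. -/
def degree : GStar Ξ Θ → ℕ :=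
  Quotient.lift (fun a : RootedMarkedGraph Ξ Θ 1 => a.G.degree (a.root 0)) (by
    rintro a b ⟨e, h1, h2, -⟩
    refine MarkedGraph.ncard_eq_of_equiv e fun v => ?_
    simp only [mem_ofPred_eq]
    rw [← h1 0, ← a.G.isSome_edgeMark_iff, ← b.G.isSome_edgeMark_iff, h2])

/-- `τ_G(o)` as a function of `[G, o]`. -/
def rootMark : GStar Ξ Θ → Θ :=
  Quotient.lift (fun a : RootedMarkedGraph Ξ Θ 1 => a.G.vertexMark (a.root 0)) (by
    rintro a b ⟨e, h1, -, h3⟩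
    rw [← h1 0, h3])

end GStar

namespace RootedMarkedGraph

variable {Ξ Θ : Type*}

/-- `[G, v, w]` for two vertices of a connected graph `G`. -/
def pairClass {k : ℕ} (a : RootedMarkedGraph Ξ Θ k) (v w : a.V) : GStarStar Ξ Θ :=
  Quotient.mk _ ⟨a.V, a.countable, a.G, a.connected, ![v, w]⟩

theorem pairClass_congr {k : ℕ} {a b : RootedMarkedGraph Ξ Θ k} (e : a.V ≃ b.V)
    (h2 : ∀ v w, b.G.edgeMark (e v) (e w) = a.G.edgeMark v w)
    (h3 : ∀ v, b.G.vertexMark (e v) = a.G.vertexMark v) (v w : a.V) :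
    b.pairClass (e v) (e w) = a.pairClass v w := by
  refine (Quotient.sound (s := setoid Ξ Θ 2) ⟨e, fun i => ?_, h2, h3⟩).symm
  fin_cases i <;> rfl

end RootedMarkedGraph

namespace GStar

variable {Ξ Θ : Type*}

/-- `∑_{v ∈ V(G)} f([G, o, v])` as a function of `[G, o]`. -/
def sumFrom (f : GStarStar Ξ Θ → ℝ≥0) : GStar Ξ Θ → ℝ≥0∞ :=
  Quotient.lift
    (fun a : RootedMarkedGraph Ξ Θ 1 => ∑' v : a.V, (f (a.pairClass (a.root 0) v) : ℝ≥0∞)) (by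
      rintro a b ⟨e, h1, h2, h3⟩
      rw [← e.tsum_eq, ← h1 0]
      simp only [RootedMarkedGraph.pairClass_congr e h2 h3])

/-- `∑_{v ∈ V(G)} f([G, v, o])` as a function of `[G, o]`. -/
def sumTo (f : GStarStar Ξ Θ → ℝ≥0) : GStar Ξ Θ → ℝ≥0∞ :=
  Quotient.lift
    (fun a : RootedMarkedGraph Ξ Θ 1 => ∑' v : a.V, (f (a.pairClass v (a.root 0)) : ℝ≥0∞)) (by
      rintro a b ⟨e, h1, h2, h3⟩
      rw [← e.tsum_eq, ← h1 0]
      simp only [RootedMarkedGraph.pairClass_congr e h2 h3])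

end GStar

section Entropy

variable {Ξ Θ : Type*}

/-- Unimodularity of a measure on the space of rooted marked graphs (mass transport principle). -/
def IsUnimodular (μ : Measure (GStar Ξ Θ)) : Prop :=
  ∀ f : GStarStar Ξ Θ → ℝ≥0, Measurable f →
    ∫⁻ g, GStar.sumFrom f g ∂μ = ∫⁻ g, GStar.sumTo f g ∂μ

/-- `deg(μ)`: the expected degree of the root. -/
def meanDegree (μ : Measure (GStar Ξ Θ)) : ℝ≥0∞ := ∫⁻ g, (g.degree : ℝ≥0∞) ∂μ

/-- `deg_{x,x'}(μ)`: the expected number of edges at the root with mark `x` towards the root and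
mark `x'` towards the other endpoint. -/
def meanMarkDegree (μ : Measure (GStar Ξ Θ)) (x x' : Ξ) : ℝ≥0∞ :=
  ∫⁻ g, (g.markDegree x x' : ℝ≥0∞) ∂μ

/-- The probability that the root has mark `θ`. -/
def rootMarkLaw (μ : Measure (GStar Ξ Θ)) (θ : Θ) : ℝ≥0∞ := μ {g | g.rootMark = θ}

/-- Average degree vectors: symmetric, nonnegative and not identically zero. -/
def IsAverageDegreeVector [Fintype Ξ] (d : Ξ → Ξ → ℝ≥0) : Prop :=
  (∀ x x', d x x' = d x' x) ∧ 0 < ∑ x, ∑ x', d x x'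

/-- `‖m‖₁ = ∑_{x ≤ x'} m(x, x')`. -/
def edgeNorm [Fintype Ξ] [LinearOrder Ξ] (m : Ξ → Ξ → ℕ) : ℕ :=
  ∑ x, ∑ x', if x ≤ x' then m x x' else 0

/-- The sequence `(m n, u n)`, `n ≥ 1`, of edge mark count vectors and vertex mark count vectors is
adapted to `(d, Q)`. (The values at `n = 0` play no role.) -/
structure IsAdapted [Fintype Ξ] [LinearOrder Ξ] [Fintype Θ] (m : ℕ → Ξ → Ξ → ℕ) (u : ℕ → Θ → ℕ)
    (d : Ξ → Ξ → ℝ≥0) (Q : Θ → ℝ≥0) : Prop where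
  symm : ∀ n, 1 ≤ n → ∀ x x', m n x x' = m n x' x
  edgeNorm_le : ∀ n, 1 ≤ n → edgeNorm (m n) ≤ n.choose 2
  sum_vertex : ∀ n, 1 ≤ n → ∑ θ, u n θ = n
  tendsto_diag : ∀ x, Tendsto (fun n => (m n x x : ℝ) / n) atTop (𝓝 ((d x x : ℝ) / 2))
  tendsto_offDiag : ∀ x x', x ≠ x' →
    Tendsto (fun n => (m n x x' : ℝ) / n) atTop (𝓝 (d x x' : ℝ))
  tendsto_vertex : ∀ θ, Tendsto (fun n => (u n θ : ℝ) / n) atTop (𝓝 (Q θ : ℝ))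
  edge_eq_zero : ∀ x x', d x x' = 0 → ∀ n, 1 ≤ n → m n x x' = 0
  vertex_eq_zero : ∀ θ, Q θ = 0 → ∀ n, 1 ≤ n → u n θ = 0

/-- The marked graphs on `n` labelled vertices with edge mark count vector `m` and vertex mark count
vector `u`. -/
def graphsWithCounts (n : ℕ) (m : Ξ → Ξ → ℕ) (u : Θ → ℕ) : Set (MarkedGraph (Fin n) Ξ Θ) :=
  {G | G.edgeMarkCount = m ∧ G.vertexMarkCount = u}

/-- Those graphs `G` for which `U(G)` is moreover at Lévy–Prokhorov distance less than `ε`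
from `μ`. -/
def graphsNear (n : ℕ) (m : Ξ → Ξ → ℕ) (u : Θ → ℕ) (μ : Measure (GStar Ξ Θ)) (ε : ℝ) :
    Set (MarkedGraph (Fin n) Ξ Θ) :=
  {G | G ∈ graphsWithCounts n m u ∧ levyProkhorovDist G.neighborhoodLaw μ < ε}

/-- The `ε`-upper BC entropy, with values in `[-∞, ∞]` and `log 0 = -∞`. -/
def upperBCEntropyEps [Fintype Ξ] [LinearOrder Ξ] (m : ℕ → Ξ → Ξ → ℕ) (u : ℕ → Θ → ℕ)
    (μ : Measure (GStar Ξ Θ)) (ε : ℝ) : EReal :=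
  limsup (fun n : ℕ =>
    (ENNReal.log ((graphsNear n (m n) (u n) μ ε).ncard : ℝ≥0∞)
      - (((edgeNorm (m n) : ℝ) * Real.log n : ℝ) : EReal)) / (n : EReal)) atTop

/-- The upper BC entropy: the limit as `ε ↓ 0` of the `ε`-upper BC entropies, which are monotone
in `ε` (see `tendsto_upperBCEntropyEps`). -/
def upperBCEntropy [Fintype Ξ] [LinearOrder Ξ] (m : ℕ → Ξ → Ξ → ℕ) (u : ℕ → Θ → ℕ)
    (μ : Measure (GStar Ξ Θ)) : EReal :=
  ⨅ ε ∈ Ioi (0 : ℝ), upperBCEntropyEps m u μ ε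

theorem upperBCEntropyEps_mono [Fintype Ξ] [LinearOrder Ξ] [Finite Θ] (m : ℕ → Ξ → Ξ → ℕ)
    (u : ℕ → Θ → ℕ) (μ : Measure (GStar Ξ Θ)) : Monotone (upperBCEntropyEps m u μ) := by
  intro ε δ h
  refine limsup_le_limsup (Eventually.of_forall fun n => ?_)
  refine EReal.div_le_div_right_of_nonneg (by positivity) (EReal.sub_le_sub ?_ le_rfl)
  refine ENNReal.log_monotone ?_
  have hsub : graphsNear n (m n) (u n) μ ε ⊆ graphsNear n (m n) (u n) μ δ :=
    fun G hG => ⟨hG.1, hG.2.trans_le h⟩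
  exact_mod_cast ncard_le_ncard hsub (toFinite _)

theorem tendsto_upperBCEntropyEps [Fintype Ξ] [LinearOrder Ξ] [Finite Θ] (m : ℕ → Ξ → Ξ → ℕ)
    (u : ℕ → Θ → ℕ) (μ : Measure (GStar Ξ Θ)) :
    Tendsto (upperBCEntropyEps m u μ) (𝓝[>] 0) (𝓝 (upperBCEntropy m u μ)) := by
  rw [upperBCEntropy, ← sInf_image]
  exact (upperBCEntropyEps_mono m u μ).tendsto_nhdsGT 0

end Entropy

end

/-! Suppose the entropy is not -∞. Then for every ε > 0 there are infinitely many n for which some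
graph with the prescribed counts is ε-close to μ, so μ is a local weak limit of finite graphs. A
function of the R-ball is constant on sets of diameter below 1/(1+R), so Lévy–Prokhorov closeness
controls integrals of bounded local functions (`RootedClass.IsLocal.lintegral_le_add`), and
inequalities between such integrals pass to μ (`lintegral_le_of_frequently`).

Existence of these graphs already gives most of the claim. The root mark is bounded and local, so
its law is Q. Mark degrees are local but unbounded; truncation gives deg_{x,x'}(μ) ≤ d_{x,x'}.
Finite graphs satisfy mass transport exactly, and the identity passes to μ first for bounded local
events, then by a π-λ argument for all Borel functions (`IsSofic.isUnimodular`).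

The bound d_{x,x'} ≤ deg_{x,x'}(μ) needs counting, because degree may concentrate on a few vertices
that the local limit does not see. If it fails, then for some δ > 0 and each K, every graph near μ
has at most 2‖m‖₁/K vertices carrying total degree at least δn. Give each edge weight 1/n and an
extra factor K for each endpoint in this set. An exponential Markov bound
(`MarkedGraph.card_le_of_forall_exists_sum_degree`) leaves at most n^‖m‖₁ exp((C - δ log K) n) such
graphs, with C independent of K. Letting K → ∞ makes the entropy -∞. -/

/-! ### Local functions and the Lévy–Prokhorov distance -/

namespace RootedMarkedGraph

variable {Ξ Θ : Type*} {k : ℕ}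

theorem ballIso_of_localDist_lt {a b : RootedMarkedGraph Ξ Θ k} {R : ℕ}
    (h : localDist a b < 1 / (1 + (R : ℝ))) : BallIso R a b := by
  by_contra H
  exact absurd (le_localDist fun h' => H (BallIso.mono R.le_succ h')) (not_le.2 h)

theorem BallIso.localDist_le {a b : RootedMarkedGraph Ξ Θ k} {R : ℕ} (h : BallIso R a b) :
    localDist a b ≤ 1 / (1 + (R : ℝ)) := by
  unfold localDist
  split_ifs with h'
  · positivity
  · obtain ⟨m, hm⟩ := not_forall.1 h'
    -- In ℕ the `sSup` of an unbounded set is 0, so boundedness is needed for the lower bound R.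
    have hbdd : BddAbove {h : ℕ | BallIso h a b} := ⟨m, fun j hj => by
      by_contra hlt
      exact hm (BallIso.mono (by omega) hj)⟩
    have : R ≤ sSup {h : ℕ | BallIso h a b} := le_csSup hbdd h
    gcongr

end RootedMarkedGraph

namespace RootedClass

variable {Ξ Θ : Type*} {k : ℕ} {α β : Type*}

/-- A function on `RootedClass Ξ Θ k` is `R`-local if it depends only on the subgraph within
distance `R` of the distinguished vertices. -/
def IsLocal (R : ℕ) (f : RootedClass Ξ Θ k → α) : Prop :=
  ∀ a b : RootedMarkedGraph Ξ Θ k, a.BallIso R b → f (Quotient.mk _ a) = f (Quotient.mk _ b)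

theorem IsLocal.mono {R S : ℕ} {f : RootedClass Ξ Θ k → α} (hf : IsLocal R f) (h : R ≤ S) :
    IsLocal S f := fun a b hab => hf a b (hab.mono h)

theorem IsLocal.comp {R : ℕ} {f : RootedClass Ξ Θ k → α} (hf : IsLocal R f) (φ : α → β) :
    IsLocal R (fun g => φ (f g)) := fun a b hab => congrArg φ (hf a b hab)

theorem IsLocal.comp₂ {γ : Type*} {R : ℕ} {f : RootedClass Ξ Θ k → α} {f' : RootedClass Ξ Θ k → β}
    (hf : IsLocal R f) (hf' : IsLocal R f') (φ : α → β → γ) :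
    IsLocal R (fun g => φ (f g) (f' g)) := fun a b hab => by
  simp only [hf a b hab, hf' a b hab]

theorem IsLocal.eq_of_dist_lt {R : ℕ} {f : RootedClass Ξ Θ k → α} (hf : IsLocal R f)
    {g g' : RootedClass Ξ Θ k} (h : dist g g' < 1 / (1 + (R : ℝ))) : f g = f g' := by
  induction g using Quotient.inductionOn with | _ a
  induction g' using Quotient.inductionOn with | _ b
  exact hf a b (RootedMarkedGraph.ballIso_of_localDist_lt h)

/-- Membership cannot change within distance 1/(1+R). Hence every preimage under a local function is
open, and local functions into any measurable space are measurable. -/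
theorem IsLocal.isOpen {R : ℕ} {A : Set (RootedClass Ξ Θ k)} (hA : IsLocal R (· ∈ A)) :
    IsOpen A := by
  refine Metric.isOpen_iff.2 fun g hg => ⟨1 / (1 + (R : ℝ)), by positivity, fun g' hg' => ?_⟩
  have := hA.eq_of_dist_lt (Metric.mem_ball.1 hg')
  exact this.mpr hg

theorem IsLocal.measurable [MeasurableSpace α] {R : ℕ} {f : RootedClass Ξ Θ k → α}
    (hf : IsLocal R f) : Measurable f := fun s _ =>
  (IsLocal.isOpen (R := R) (A := f ⁻¹' s) (hf.comp (· ∈ s))).measurableSet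

theorem IsLocal.thickening_eq {R : ℕ} {A : Set (RootedClass Ξ Θ k)} (hA : IsLocal R (· ∈ A))
    {ε : ℝ} (hε : ε ≤ 1 / (1 + (R : ℝ))) : Metric.thickening ε A ⊆ A := by
  intro g hg
  obtain ⟨g', hg', h⟩ := Metric.mem_thickening_iff.1 hg
  exact (hA.eq_of_dist_lt (h.trans_le hε)).mpr hg'

/-- Thickening by ε ≤ 1/(1+R) does not enlarge a local set, so only the additive error of the
Lévy–Prokhorov inequality remains. -/
theorem IsLocal.measure_le_add {R : ℕ} {A : Set (RootedClass Ξ Θ k)} (hA : IsLocal R (· ∈ A))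
    {μ ν : Measure (RootedClass Ξ Θ k)} [IsFiniteMeasure μ] [IsFiniteMeasure ν] {ε : ℝ}
    (hε : ε ≤ 1 / (1 + (R : ℝ))) (h : levyProkhorovDist μ ν < ε) :
    μ A ≤ ν A + ENNReal.ofReal ε := by
  have hε0 : 0 ≤ ε := ENNReal.toReal_nonneg.trans h.le
  have h' : levyProkhorovEDist μ ν < ENNReal.ofReal ε :=
    (ENNReal.lt_ofReal_iff_toReal_lt (levyProkhorovEDist_ne_top μ ν)).2 h
  refine (left_measure_le_of_levyProkhorovEDist_lt h' hA.isOpen.measurableSet).trans ?_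
  rw [ENNReal.toReal_ofReal hε0]
  gcongr
  exact hA.thickening_eq hε

/-- Layer-cake formula: every superlevel set of a local function is local. -/
theorem IsLocal.lintegral_le_add {R : ℕ} {F : RootedClass Ξ Θ k → ℝ≥0∞} (hF : IsLocal R F)
    {N : ℝ≥0} (hN : ∀ g, F g ≤ N)
    {μ ν : Measure (RootedClass Ξ Θ k)} [IsFiniteMeasure μ] [IsFiniteMeasure ν] {ε : ℝ}
    (hε : ε ≤ 1 / (1 + (R : ℝ))) (h : levyProkhorovDist μ ν < ε) :
    ∫⁻ g, F g ∂μ ≤ ∫⁻ g, F g ∂ν + ENNReal.ofReal ε * N := by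
  have key : ∀ κ : Measure (RootedClass Ξ Θ k),
      ∫⁻ g, F g ∂κ = ∫⁻ t in Ioi (0 : ℝ), κ {g | t < (F g).toReal} := fun κ => by
    rw [← lintegral_eq_lintegral_meas_lt κ (Eventually.of_forall fun g => ENNReal.toReal_nonneg)
      (hF.comp ENNReal.toReal).measurable.aemeasurable]
    exact lintegral_congr fun g =>
      (ENNReal.ofReal_toReal ((hN g).trans_lt ENNReal.coe_lt_top).ne).symm
  rw [key, key]
  have hle : ∀ t ∈ Ioi (0 : ℝ), μ {g | t < (F g).toReal} ≤
      ν {g | t < (F g).toReal} + (Iio (N : ℝ)).indicator (fun _ => ENNReal.ofReal ε) t := by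
    intro t _
    by_cases ht : t < N
    · rw [indicator_of_mem (by exact ht)]
      exact IsLocal.measure_le_add (hF.comp fun x => t < x.toReal) hε h
    -- Superlevel sets at heights t ≥ N are empty, so the error ε is integrated over (0, N) only.
    · have : {g | t < (F g).toReal} = ∅ := eq_empty_of_forall_notMem fun g hg => ht <|
        lt_of_lt_of_le hg (by simpa using ENNReal.toReal_mono ENNReal.coe_ne_top (hN g))
      rw [this, measure_empty]; exact zero_le
  refine (setLIntegral_mono' measurableSet_Ioi hle).trans ?_
  rw [lintegral_add_right _ (measurable_const.indicator measurableSet_Iio)]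
  gcongr
  rw [lintegral_indicator measurableSet_Iio, setLIntegral_const,
    Measure.restrict_apply measurableSet_Iio, inter_comm, Ioi_inter_Iio, Real.volume_Ioo, sub_zero,
    ENNReal.ofReal_coe_nnreal]

end RootedClass

/-! ### Locality of the root mark and the mark degrees -/

namespace GStar

open RootedClass

variable {Ξ Θ : Type*}

theorem isLocal_rootMark : IsLocal 1 (rootMark : GStar Ξ Θ → Θ) := by
  rintro a b ⟨e, h1, -, h3⟩
  have h := h3 ⟨a.root 0, a.root_mem_ball 1 0⟩
  rw [h1 0] at h
  exact h.symm

theorem isLocal_markDegree (x x' : Ξ) : IsLocal 1 (markDegree x x' : GStar Ξ Θ → ℕ) := by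
  have key : ∀ a : RootedMarkedGraph Ξ Θ 1, a.G.markDegree x x' (a.root 0) =
      (a.G.induce (a.ball 1)).markDegree x x' ⟨a.root 0, a.root_mem_ball 1 0⟩ := fun a => by
    unfold MarkedGraph.markDegree
    rw [← ncard_image_of_injective _ Subtype.val_injective]
    congr 1
    ext v
    constructor
    · rintro ⟨h1, h2⟩
      have hadj : a.G.graph.Adj (a.root 0) v := by rw [← a.G.isSome_edgeMark_iff, h2]; rfl
      exact ⟨⟨v, 0, (SimpleGraph.dist_eq_one_iff_adj.2 hadj).le⟩, ⟨h1, h2⟩, rfl⟩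
    · rintro ⟨v, ⟨h1, h2⟩, rfl⟩
      exact ⟨h1, h2⟩
  rintro a b ⟨e, h1, h2, -⟩
  change a.G.markDegree x x' (a.root 0) = b.G.markDegree x x' (b.root 0)
  rw [key, key]
  refine MarkedGraph.ncard_eq_of_equiv e fun v => ?_
  have : e ⟨a.root 0, a.root_mem_ball 1 0⟩ = ⟨b.root 0, b.root_mem_ball 1 0⟩ := h1 0
  simp only [mem_ofPred_eq]
  rw [← this, h2, h2]

end GStar

/-! ### Finite graphs: mass transport and degree sums -/

namespace MarkedGraph

variable {Ξ Θ : Type*} {V : Type}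

theorem edgeMark_ne_none {G : MarkedGraph V Ξ Θ} {v w : V} {x : Ξ} (h : G.edgeMark v w = some x) :
    G.graph.Adj v w := by
  rw [← G.isSome_edgeMark_iff, h]; rfl

theorem exists_edgeMark {G : MarkedGraph V Ξ Θ} {v w : V} (h : G.graph.Adj v w) :
    ∃ x, G.edgeMark v w = some x :=
  Option.isSome_iff_exists.1 ((G.isSome_edgeMark_iff v w).2 h)

theorem markDegree_rootedClass [Countable V] (G : MarkedGraph V Ξ Θ) (x x' : Ξ) (v : V) :
    (G.rootedClass v).markDegree x x' = G.markDegree x x' v := by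
  change (G.induce {w | G.graph.Reachable v w}).markDegree x x' ⟨v, SimpleGraph.Reachable.refl v⟩ =
    G.markDegree x x' v
  unfold markDegree
  rw [← ncard_image_of_injective _ Subtype.val_injective]
  congr 1
  ext w
  constructor
  · rintro ⟨w, h, rfl⟩
    exact h
  · rintro ⟨h1, h2⟩
    exact ⟨⟨w, (edgeMark_ne_none h2).reachable⟩, ⟨h1, h2⟩, rfl⟩

section Finite

variable [Fintype V]

instance [Nonempty V] (G : MarkedGraph V Ξ Θ) : IsFiniteMeasure G.neighborhoodLaw := by
  unfold neighborhoodLaw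
  refine ⟨?_⟩
  rw [Measure.smul_apply, smul_eq_mul]
  refine ENNReal.mul_lt_top (by simp [ENNReal.inv_lt_top, Fintype.card_pos])
    (measure_lt_top _ _)

theorem lintegral_neighborhoodLaw (G : MarkedGraph V Ξ Θ) {F : GStar Ξ Θ → ℝ≥0∞}
    (hF : Measurable F) :
    ∫⁻ g, F g ∂G.neighborhoodLaw = (Fintype.card V : ℝ≥0∞)⁻¹ * ∑ v, F (G.rootedClass v) := by
  simp [neighborhoodLaw, lintegral_smul_measure, lintegral_finsetSum_measure, lintegral_dirac' _ hF]

/-- The mass transport principle for a uniform root of a finite graph. -/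
theorem sum_sumFrom_rootedClass (G : MarkedGraph V Ξ Θ) (f : GStarStar Ξ Θ → ℝ≥0) :
    ∑ v, GStar.sumFrom f (G.rootedClass v) = ∑ v, GStar.sumTo f (G.rootedClass v) := by
  classical
  -- `P o v w` is f at the component of o with v, w distinguished, and 0 if one of them lies
  -- outside. It depends on o only through the component, so mass transport becomes an exchange of
  -- two finite sums.
  let P : V → V → V → ℝ≥0∞ := fun o v w =>
    if h : G.graph.Reachable o v ∧ G.graph.Reachable o w then
      (f (Quotient.mk _ ⟨{v | G.graph.Reachable o v}, inferInstance,
        G.induce {v | G.graph.Reachable o v}, by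
        have h := (G.graph.connectedComponentMk o).connected_toSimpleGraph
        have hs : (G.graph.connectedComponentMk o).supp = {v | G.graph.Reachable o v} := by
          ext v
          simp only [SimpleGraph.ConnectedComponent.mem_supp_iff,
            SimpleGraph.ConnectedComponent.eq, mem_ofPred_eq]
          exact ⟨fun h => h.symm, fun h => h.symm⟩
        exact hs ▸ h, ![⟨v, h.1⟩, ⟨w, h.2⟩]⟩) : ℝ≥0∞) else 0
  have hP : ∀ o o' v w, G.graph.Reachable o o' → P o v w = P o' v w := by
    intro o o' v w h
    have hs : {v | G.graph.Reachable o v} = {v | G.graph.Reachable o' v} := by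
      ext v
      exact ⟨fun hv => h.symm.trans hv, fun hv => h.trans hv⟩
    have hiff : ∀ v, G.graph.Reachable o v ↔ G.graph.Reachable o' v := fun v =>
      (Set.ext_iff.1 hs v)
    simp only [P, hiff]
    by_cases hvw : G.graph.Reachable o' v ∧ G.graph.Reachable o' w
    · rw [dif_pos hvw, dif_pos hvw]
      congr 2
      refine Quotient.sound (s := RootedMarkedGraph.setoid Ξ Θ 2)
        ⟨Equiv.setCongr hs, fun i => ?_, fun _ _ => rfl, fun _ => rfl⟩
      fin_cases i <;> rfl
    · rw [dif_neg hvw, dif_neg hvw]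
  have h1 : ∀ o, GStar.sumFrom f (G.rootedClass o) = ∑ v, P o o v := fun o => by
    change (∑' v : {v | G.graph.Reachable o v}, _) = _
    rw [← tsum_fintype (L := .unconditional V), ← tsum_subtype_eq_of_support_subset
      (s := {v | G.graph.Reachable o v})]
    · refine tsum_congr fun v => ?_
      simp only [P]
      rw [dif_pos ⟨SimpleGraph.Reachable.refl o, v.2⟩]
      rfl
    · intro v hv
      by_contra hn
      exact hv (dif_neg fun h => hn h.2)
  have h2 : ∀ o, GStar.sumTo f (G.rootedClass o) = ∑ v, P o v o := fun o => by
    change (∑' v : {v | G.graph.Reachable o v}, _) = _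
    rw [← tsum_fintype (L := .unconditional V), ← tsum_subtype_eq_of_support_subset
      (s := {v | G.graph.Reachable o v})]
    · refine tsum_congr fun v => ?_
      simp only [P]
      rw [dif_pos ⟨v.2, SimpleGraph.Reachable.refl o⟩]
      rfl
    · intro v hv
      by_contra hn
      exact hv (dif_neg fun h => hn h.1)
  simp only [h1, h2]
  rw [Finset.sum_comm]
  refine Finset.sum_congr rfl fun v _ => Finset.sum_congr rfl fun o _ => ?_
  by_cases h : G.graph.Reachable o v
  · exact hP _ _ _ _ h
  · simp only [P]
    rw [dif_neg fun h' => h h'.2, dif_neg fun h' => h h'.1.symm]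

open Classical in
theorem markDegree_eq_card (G : MarkedGraph V Ξ Θ) (x x' : Ξ) (o : V) : G.markDegree x x' o =
    (Finset.univ.filter fun v => G.edgeMark v o = some x ∧ G.edgeMark o v = some x').card := by
  rw [markDegree, ← ncard_coe_finset]
  simp

open Classical in
theorem degree_eq_card (G : MarkedGraph V Ξ Θ) (o : V) : G.degree o =
    (Finset.univ.filter fun v => G.graph.Adj o v).card := by
  rw [degree, ← ncard_coe_finset]
  simp

theorem markDegree_le_degree (G : MarkedGraph V Ξ Θ) (x x' : Ξ) (o : V) :
    G.markDegree x x' o ≤ G.degree o :=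
  ncard_le_ncard (fun _ hv => edgeMark_ne_none hv.2) (toFinite _)

theorem sum_markDegree (G : MarkedGraph V Ξ Θ) (x x' : Ξ) : ∑ v, G.markDegree x x' v =
    {p : V × V | G.edgeMark p.1 p.2 = some x ∧ G.edgeMark p.2 p.1 = some x'}.ncard := by
  classical
  simp only [markDegree_eq_card]
  rw [← Finset.card_sigma, ← ncard_coe_finset]
  refine ncard_eq_of_equiv ((Equiv.sigmaEquivProd V V).trans (Equiv.prodComm V V)) fun v => ?_
  simp

theorem sum_markDegree_of_ne (G : MarkedGraph V Ξ Θ) {x x' : Ξ} (hx : x ≠ x') :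
    ∑ v, G.markDegree x x' v = G.edgeMarkCount x x' := by
  rw [sum_markDegree, edgeMarkCount]
  refine ncard_congr (fun p _ => s(p.1, p.2)) (fun p hp => ⟨p.1, p.2, rfl, hp⟩) ?_ ?_
  · rintro ⟨v, w⟩ ⟨v', w'⟩ h h' heq
    rcases Sym2.eq_iff.1 heq with ⟨rfl, rfl⟩ | ⟨rfl, rfl⟩
    · rfl
    · exact absurd (Option.some_injective _ (h.1.symm.trans h'.2)) hx
  · rintro e ⟨v, w, rfl, h⟩
    exact ⟨(v, w), h, rfl⟩

/-- An edge with both marks equal to x is counted at both of its endpoints; the order on `V` splits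
the ordered pairs into two equal halves. -/
theorem sum_markDegree_self [LinearOrder V] (G : MarkedGraph V Ξ Θ) (x : Ξ) :
    ∑ v, G.markDegree x x v = 2 * G.edgeMarkCount x x := by
  have hlt : {p : V × V | p.1 < p.2 ∧ G.edgeMark p.1 p.2 = some x ∧
      G.edgeMark p.2 p.1 = some x}.ncard = G.edgeMarkCount x x := by
    rw [edgeMarkCount]
    refine ncard_congr (fun p _ => s(p.1, p.2)) (fun p hp => ⟨p.1, p.2, rfl, hp.2⟩) ?_ ?_
    · rintro ⟨v, w⟩ ⟨v', w'⟩ h h' heq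
      rcases Sym2.eq_iff.1 heq with ⟨rfl, rfl⟩ | ⟨rfl, rfl⟩
      · rfl
      · exact absurd h.1 (not_lt.2 h'.1.le)
    · rintro e ⟨v, w, rfl, h⟩
      rcases lt_or_gt_of_ne (edgeMark_ne_none h.1).ne with hvw | hvw
      · exact ⟨(v, w), ⟨hvw, h⟩, rfl⟩
      · exact ⟨(w, v), ⟨hvw, h.2, h.1⟩, Sym2.eq_swap⟩
  have hgt : {p : V × V | p.2 < p.1 ∧ G.edgeMark p.1 p.2 = some x ∧
      G.edgeMark p.2 p.1 = some x}.ncard = G.edgeMarkCount x x := by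
    rw [← hlt]
    refine ncard_eq_of_equiv (Equiv.prodComm V V) fun p => ?_
    simp [and_comm]
  rw [sum_markDegree, two_mul]
  nth_rewrite 1 [← hlt]
  rw [← hgt, ← ncard_union_eq]
  · congr 1
    ext p
    constructor
    · intro h
      rcases lt_or_gt_of_ne (edgeMark_ne_none h.1).ne with hvw | hvw
      · exact Or.inl ⟨hvw, h⟩
      · exact Or.inr ⟨hvw, h⟩
    · rintro (h | h) <;> exact h.2
  · exact disjoint_left.2 fun p h h' => lt_asymm h.1 h'.1

end Finite

end MarkedGraph

/-! ### Counting graphs with a small set of large total degree -/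

namespace MarkedGraph

variable {Ξ Θ : Type*} {V : Type} [Fintype V] [LinearOrder V] [Fintype Ξ] [LinearOrder Ξ]

open Classical in
/-- The edges of `G`, each listed once, from the smaller to the larger endpoint, with its marks. -/
noncomputable def orientedEdges (G : MarkedGraph V Ξ Θ) : Finset (V × V × Ξ × Ξ) :=
  Finset.univ.filter fun p => p.1 < p.2.1 ∧ G.edgeMark p.1 p.2.1 = some p.2.2.1 ∧
    G.edgeMark p.2.1 p.1 = some p.2.2.2

theorem mem_orientedEdges {G : MarkedGraph V Ξ Θ} {p : V × V × Ξ × Ξ} :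
    p ∈ G.orientedEdges ↔ p.1 < p.2.1 ∧ G.edgeMark p.1 p.2.1 = some p.2.2.1 ∧
      G.edgeMark p.2.1 p.1 = some p.2.2.2 := by
  simp [orientedEdges]

theorem ext_of_orientedEdges {G H : MarkedGraph V Ξ Θ} (h1 : G.vertexMark = H.vertexMark)
    (h2 : G.orientedEdges = H.orientedEdges) : G = H := by
  have key : ∀ {G H : MarkedGraph V Ξ Θ}, G.orientedEdges = H.orientedEdges →
      ∀ v w x, G.edgeMark v w = some x → H.edgeMark v w = some x := by
    intro G H h v w x hx
    obtain ⟨x', hx'⟩ := exists_edgeMark (edgeMark_ne_none hx).symm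
    rcases lt_or_gt_of_ne (edgeMark_ne_none hx).ne with hvw | hvw
    · have : (v, w, x, x') ∈ G.orientedEdges := mem_orientedEdges.2 ⟨hvw, hx, hx'⟩
      rw [h] at this
      exact (mem_orientedEdges.1 this).2.1
    · have : (w, v, x', x) ∈ G.orientedEdges := mem_orientedEdges.2 ⟨hvw, hx', hx⟩
      rw [h] at this
      exact (mem_orientedEdges.1 this).2.2
  have hmark : G.edgeMark = H.edgeMark := by
    funext v w
    exact Option.ext fun x => ⟨key h2 v w x, key h2.symm v w x⟩
  refine MarkedGraph.ext ?_ hmark h1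
  ext v w
  rw [← G.isSome_edgeMark_iff, ← H.isSome_edgeMark_iff, hmark]

theorem card_orientedEdges_le (G : MarkedGraph V Ξ Θ) :
    G.orientedEdges.card ≤ edgeNorm G.edgeMarkCount := by
  classical
  let E : Ξ × Ξ → Finset (Sym2 V) := fun q =>
    {e : Sym2 V | ∃ v w, e = s(v, w) ∧ G.edgeMark v w = some q.1 ∧
      G.edgeMark w v = some q.2}.toFinset
  have hE : ∀ q, (E q).card = G.edgeMarkCount q.1 q.2 := fun q => by
    rw [edgeMarkCount, ncard_eq_toFinset_card']
  have h1 : G.orientedEdges.card ≤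
      ((Finset.univ.filter fun q : Ξ × Ξ => q.1 ≤ q.2).biUnion E).card := by
    refine Finset.card_le_card_of_injOn (fun p => s(p.1, p.2.1)) ?_ ?_
    · rintro ⟨v, w, x, x'⟩ hp
      obtain ⟨h, hx, hx'⟩ := mem_orientedEdges.1 hp
      simp only [Finset.coe_biUnion, mem_iUnion]
      rcases le_total x x' with hle | hle
      · exact ⟨(x, x'), by simpa using hle, by simpa [E] using ⟨v, w, Or.inl ⟨rfl, rfl⟩, hx, hx'⟩⟩
      · exact ⟨(x', x), by simpa using hle, by simpa [E] using ⟨w, v, Or.inr ⟨rfl, rfl⟩, hx', hx⟩⟩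
    · rintro ⟨v, w, x, x'⟩ hp ⟨v₁, w₁, x₁, x₁'⟩ hp₁ heq
      obtain ⟨h, hx, hx'⟩ := mem_orientedEdges.1 hp
      obtain ⟨h₁, hx₁, hx₁'⟩ := mem_orientedEdges.1 hp₁
      rcases Sym2.eq_iff.1 heq with ⟨h3, h4⟩ | ⟨h3, h4⟩ <;> dsimp only at *
      · subst h3 h4
        cases Option.some_injective _ (hx.symm.trans hx₁)
        cases Option.some_injective _ (hx'.symm.trans hx₁')
        rfl
      · subst h3 h4
        exact absurd h (not_lt.2 h₁.le)
  refine h1.trans (Finset.card_biUnion_le.trans (le_of_eq ?_))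
  rw [edgeNorm, Finset.sum_filter, ← Finset.univ_product_univ, Finset.sum_product]
  simp only [hE]

theorem sum_degree_le (G : MarkedGraph V Ξ Θ) (S : Finset V) :
    ∑ v ∈ S, G.degree v ≤
      ∑ p ∈ G.orientedEdges, ((if p.1 ∈ S then 1 else 0) + if p.2.1 ∈ S then 1 else 0) := by
  classical
  rw [Finset.sum_add_distrib, ← Finset.sum_filter, ← Finset.sum_filter, ← Finset.card_eq_sum_ones,
    ← Finset.card_eq_sum_ones]
  simp only [degree_eq_card]
  rw [← Finset.card_sigma, ← Finset.card_filter_add_card_filter_not (fun p => p.1 < p.2)]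
  gcongr
  · refine Finset.card_le_card_of_surjOn (fun p => ⟨p.1, p.2.1⟩) ?_
    rintro ⟨v, w⟩ h
    simp only [Finset.coe_filter, Finset.mem_sigma, Finset.mem_filter, Finset.mem_univ, true_and,
      mem_ofPred_eq] at h
    obtain ⟨x, hx⟩ := exists_edgeMark h.1.2
    obtain ⟨x', hx'⟩ := exists_edgeMark h.1.2.symm
    exact ⟨(v, w, x, x'), by simpa [mem_orientedEdges] using ⟨⟨h.2, hx, hx'⟩, h.1.1⟩, rfl⟩
  · refine Finset.card_le_card_of_surjOn (fun p => ⟨p.2.1, p.1⟩) ?_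
    rintro ⟨v, w⟩ h
    simp only [Finset.coe_filter, Finset.mem_sigma, Finset.mem_filter, Finset.mem_univ, true_and,
      mem_ofPred_eq] at h
    obtain ⟨x, hx⟩ := exists_edgeMark h.1.2
    obtain ⟨x', hx'⟩ := exists_edgeMark h.1.2.symm
    have hlt : w < v := lt_of_le_of_ne (not_lt.1 h.2) h.1.2.ne'
    exact ⟨(w, v, x', x), by simpa [mem_orientedEdges] using ⟨⟨hlt, hx', hx⟩, h.1.1⟩, rfl⟩

theorem sum_degree_le_two_mul (G : MarkedGraph V Ξ Θ) (S : Finset V) :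
    ∑ v ∈ S, G.degree v ≤ 2 * edgeNorm G.edgeMarkCount := by
  refine (G.sum_degree_le S).trans ?_
  refine (Finset.sum_le_card_nsmul _ _ 2 fun p _ => ?_).trans ?_
  · split_ifs <;> simp
  · rw [smul_eq_mul, mul_comm]
    gcongr
    exact G.card_orientedEdges_le

omit [LinearOrder Ξ] in
/-- The generating function of sets of marked oriented pairs, weighted by the number of endpoints
in `S`. -/
theorem sum_prod_weight_le (S : Finset V) {c r : ℝ} (hc : 0 ≤ c) (hr : 1 ≤ r) {B : ℝ}
    (hB : r * S.card ≤ B) :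
    ∑ D : Finset (V × V × Ξ × Ξ), ∏ p ∈ D, (r ^ ((if p.1 ∈ S then 1 else 0) +
        if p.2.1 ∈ S then 1 else 0) * c) ≤
      Real.exp ((Fintype.card Ξ : ℝ) ^ 2 * (Fintype.card V + B) ^ 2 * c) := by
  have hS : ∑ v : V, r ^ (if v ∈ S then 1 else 0) ≤ Fintype.card V + B := by
    have : ∀ v : V, r ^ (if v ∈ S then 1 else 0) ≤ 1 + if v ∈ S then r else 0 := fun v => by
      split_ifs <;> simp
    refine (Finset.sum_le_sum fun v _ => this v).trans ?_
    rw [Finset.sum_add_distrib, ← Finset.sum_filter]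
    simpa [mul_comm] using hB
  have h0 : 0 ≤ ∑ v : V, r ^ (if v ∈ S then 1 else 0) := Finset.sum_nonneg fun v _ => by positivity
  -- The sum runs over all sets of marked ordered pairs, not only edge sets of graphs, so it factors
  -- as ∏ (1 + weight) ≤ exp(∑ weight). The total weight is c |Ξ|² times the square of the sum over
  -- vertices.
  rw [← Finset.powerset_univ, ← Finset.prod_one_add]
  calc _ ≤ ∏ p : V × V × Ξ × Ξ, Real.exp (r ^ ((if p.1 ∈ S then 1 else 0) +
        if p.2.1 ∈ S then 1 else 0) * c) :=
        Finset.prod_le_prod (fun p _ => by positivity) fun p _ => by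
          rw [add_comm]; exact Real.add_one_le_exp _
    _ = Real.exp ((Fintype.card Ξ : ℝ) ^ 2 * (∑ v : V, r ^ (if v ∈ S then 1 else 0)) ^ 2 * c) := by
        rw [← Real.exp_sum, ← Finset.sum_mul]
        congr 2
        simp only [pow_add, ← Finset.univ_product_univ, Finset.sum_product]
        simp only [sq, Finset.sum_mul, Finset.mul_sum]
        rw [Finset.sum_comm]
        refine Finset.sum_congr rfl fun v _ => Finset.sum_congr rfl fun w _ => ?_
        change ∑ _x : Ξ, ∑ _y : Ξ, (r ^ (if w ∈ S then 1 else 0)) * r ^ (if v ∈ S then 1 else 0) = _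
        simp only [Finset.sum_const, Finset.card_univ, nsmul_eq_mul]
        ring
    _ ≤ _ := by gcongr

/-- A bound on the number of marked graphs in which a small set of vertices has a large total
degree. -/
theorem card_le_of_forall_exists_sum_degree [Nonempty V] [Fintype Θ]
    (𝓖 : Finset (MarkedGraph V Ξ Θ)) {M K : ℕ} (hK : 1 ≤ K) {t : ℝ}
    (hM : ∀ G ∈ 𝓖, edgeNorm G.edgeMarkCount ≤ M)
    (hS : ∀ G ∈ 𝓖, ∃ S : Finset V, K * S.card ≤ 2 * M ∧ t ≤ (∑ v ∈ S, G.degree v : ℕ)) :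
    (𝓖.card : ℝ) ≤ (Fintype.card V : ℝ) ^ M * ((K : ℝ) ^ t)⁻¹ *
      ((Fintype.card Θ : ℝ) ^ Fintype.card V * 2 ^ Fintype.card V *
      Real.exp ((Fintype.card Ξ : ℝ) ^ 2 * (Fintype.card V + 2 * M) ^ 2 * (Fintype.card V : ℝ)⁻¹))
      := by
  classical
  choose! S hS1 hS2 using hS
  set n : ℝ := (Fintype.card V : ℝ) with hn
  have hn1 : 1 ≤ n := Nat.one_le_cast.2 (Fintype.card_pos (α := V))
  have hK' : (1 : ℝ) ≤ K := by exact_mod_cast hK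
  let w : Finset V → Finset (V × V × Ξ × Ξ) → ℝ := fun S D =>
    ∏ p ∈ D, ((K : ℝ) ^ ((if p.1 ∈ S then 1 else 0) + if p.2.1 ∈ S then 1 else 0) * n⁻¹)
  have hw0 : ∀ S D, 0 ≤ w S D := fun S D => Finset.prod_nonneg fun p _ => by positivity
  -- Exponential Markov inequality: the edge set of G has at most M elements, and its endpoints hit
  -- `S G` at least t times.
  have hw : ∀ G ∈ 𝓖, 1 ≤ n ^ M * ((K : ℝ) ^ t)⁻¹ * w (S G) G.orientedEdges := by
    intro G hG
    simp only [w]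
    rw [Finset.prod_mul_distrib, Finset.prod_pow_eq_pow_sum, Finset.prod_const]
    have h1 : (K : ℝ) ^ t ≤ (K : ℝ) ^ (∑ p ∈ G.orientedEdges,
        ((if p.1 ∈ S G then 1 else 0) + if p.2.1 ∈ S G then 1 else 0) : ℕ) := by
      rw [← Real.rpow_natCast]
      refine Real.rpow_le_rpow_of_exponent_le hK' ((hS2 G hG).trans ?_)
      exact_mod_cast G.sum_degree_le (S G)
    have h2 : n ^ G.orientedEdges.card ≤ n ^ M :=
      pow_le_pow_right₀ hn1 (G.card_orientedEdges_le.trans (hM G hG))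
    have h3 : 0 < (K : ℝ) ^ t := Real.rpow_pos_of_pos (by positivity) _
    have h4 : 0 < n ^ G.orientedEdges.card := by positivity
    rw [inv_pow]
    calc (1 : ℝ) = n ^ G.orientedEdges.card * ((K : ℝ) ^ t)⁻¹ *
          ((K : ℝ) ^ t * (n ^ G.orientedEdges.card)⁻¹) := by field_simp
      _ ≤ _ := by gcongr
  calc (𝓖.card : ℝ) = ∑ G ∈ 𝓖, 1 := by simp
    _ ≤ ∑ G ∈ 𝓖, n ^ M * ((K : ℝ) ^ t)⁻¹ * w (S G) G.orientedEdges := Finset.sum_le_sum hw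
    _ = n ^ M * ((K : ℝ) ^ t)⁻¹ * ∑ G ∈ 𝓖, w (S G) G.orientedEdges := by rw [Finset.mul_sum]
    -- The set `S G` is recorded beside the edge set so that the two can next vary independently;
    -- for fixed S the sum over edge sets is the generating function above.
    _ = n ^ M * ((K : ℝ) ^ t)⁻¹ *
        ∑ q ∈ 𝓖.image fun G => ((G.vertexMark, S G), G.orientedEdges), w q.1.2 q.2 := by
        rw [Finset.sum_image]
        intro G _ H _ h
        simp only [Prod.mk.injEq] at h
        exact ext_of_orientedEdges h.1.1 h.2
    _ ≤ n ^ M * ((K : ℝ) ^ t)⁻¹ * ∑ q ∈ (Finset.univ ×ˢ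
        Finset.univ.filter fun S : Finset V => K * S.card ≤ 2 * M) ×ˢ Finset.univ,
          w q.1.2 q.2 := by
        refine mul_le_mul_of_nonneg_left (Finset.sum_le_sum_of_subset_of_nonneg ?_
          fun q _ _ => hw0 _ _) (by positivity)
        intro q hq
        obtain ⟨G, hG, rfl⟩ := Finset.mem_image.1 hq
        simpa using hS1 G hG
    _ = n ^ M * ((K : ℝ) ^ t)⁻¹ * ∑ q ∈ (Finset.univ : Finset (V → Θ)) ×ˢ
        Finset.univ.filter fun S : Finset V => K * S.card ≤ 2 * M, ∑ D, w q.2 D := by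
        rw [Finset.sum_product]
    _ ≤ n ^ M * ((K : ℝ) ^ t)⁻¹ * ∑ q ∈ (Finset.univ : Finset (V → Θ)) ×ˢ
        Finset.univ.filter fun S : Finset V => K * S.card ≤ 2 * M,
          Real.exp ((Fintype.card Ξ : ℝ) ^ 2 * (n + 2 * M) ^ 2 * n⁻¹) := by
        gcongr with q hq
        refine sum_prod_weight_le q.2 (by positivity) hK' ?_
        have := (Finset.mem_filter.1 (Finset.mem_product.1 hq).2).2
        exact_mod_cast this
    _ ≤ _ := by
        rw [Finset.sum_const, nsmul_eq_mul, Finset.card_product]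
        gcongr
        push_cast
        gcongr
        · simp
        · refine (Nat.cast_le.2 (Finset.card_filter_le _ _)).trans ?_
          simp

end MarkedGraph

/-! ### Passage to the limit and the law of the root mark -/

section Entropy

variable {Ξ Θ : Type*} [Fintype Ξ] [LinearOrder Ξ]

theorem upperBCEntropy_eq_bot_of_forall_ncard_le {m : ℕ → Ξ → Ξ → ℕ} {u : ℕ → Θ → ℕ}
    {μ : Measure (GStar Ξ Θ)}
    (h : ∀ C : ℝ, ∃ ε > 0, ∀ᶠ n : ℕ in atTop, ((graphsNear n (m n) (u n) μ ε).ncard : ℝ) ≤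
      (n : ℝ) ^ edgeNorm (m n) * Real.exp (C * n)) :
    upperBCEntropy m u μ = ⊥ := by
  refine EReal.eq_bot_iff_forall_lt _ |>.2 fun C => ?_
  obtain ⟨ε, hε, hn⟩ := h (C - 1)
  refine lt_of_le_of_lt ((iInf₂_le ε hε).trans (limsup_le_of_le (h := ?_)))
    (show ((C - 1 : ℝ) : EReal) < C by exact_mod_cast sub_one_lt C)
  filter_upwards [hn, eventually_ge_atTop 1] with n hn hn1
  have hn0 : (0 : ℝ) < n := by exact_mod_cast hn1
  have hexp : (n : ℝ) ^ edgeNorm (m n) * Real.exp ((C - 1) * n) =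
      Real.exp (edgeNorm (m n) * Real.log n + (C - 1) * n) := by
    rw [Real.exp_add, mul_comm (edgeNorm (m n) : ℝ), Real.exp_mul (Real.log n), Real.exp_log hn0,
      Real.rpow_natCast]
  rw [hexp] at hn
  have hlog : ENNReal.log ((graphsNear n (m n) (u n) μ ε).ncard : ℝ≥0∞) ≤
      ((edgeNorm (m n) * Real.log n + (C - 1) * n : ℝ) : EReal) := by
    have h1 : ((graphsNear n (m n) (u n) μ ε).ncard : ℝ≥0∞) ≤
        ENNReal.ofReal (Real.exp (edgeNorm (m n) * Real.log n + (C - 1) * n)) := by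
      rw [← ENNReal.ofReal_natCast]
      exact ENNReal.ofReal_le_ofReal hn
    refine (ENNReal.log_monotone h1).trans (le_of_eq ?_)
    rw [ENNReal.log_ofReal_of_pos (Real.exp_pos _), Real.log_exp]
  calc _ ≤ (((C - 1) * n : ℝ) : EReal) / (n : EReal) := by
        refine EReal.div_le_div_right_of_nonneg (by positivity) (EReal.sub_le_of_le_add ?_)
        rw [← EReal.coe_add, add_comm]
        exact hlog
    _ = ((C - 1 : ℝ) : EReal) := by
        rw [← EReal.coe_natCast, ← EReal.coe_div, mul_div_cancel_right₀ _ hn0.ne']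

/-- If these sets were eventually empty, their cardinality 0 would satisfy every exponential bound.
-/
theorem frequently_graphsNear_nonempty {m : ℕ → Ξ → Ξ → ℕ} {u : ℕ → Θ → ℕ}
    {μ : Measure (GStar Ξ Θ)} (h : upperBCEntropy m u μ ≠ ⊥) {ε : ℝ} (hε : 0 < ε) :
    ∃ᶠ n : ℕ in atTop, (graphsNear n (m n) (u n) μ ε).Nonempty := by
  by_contra H
  refine h (upperBCEntropy_eq_bot_of_forall_ncard_le fun C => ⟨ε, hε, ?_⟩)
  filter_upwards [not_frequently.1 H] with n hn
  rw [not_nonempty_iff_eq_empty.1 hn, ncard_empty, Nat.cast_zero]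
  positivity

omit [Fintype Ξ] [LinearOrder Ξ] in
/-- Inequalities between integrals of bounded local functions pass to local weak limits. -/
theorem lintegral_le_of_frequently {μ : Measure (GStar Ξ Θ)} [IsFiniteMeasure μ] {R : ℕ}
    {F F' : GStar Ξ Θ → ℝ≥0∞} (hF : RootedClass.IsLocal R F) (hF' : RootedClass.IsLocal R F')
    {N : ℝ≥0} (hN : ∀ g, F g ≤ N) (hN' : ∀ g, F' g ≤ N) {c c' : ℕ → ℝ≥0∞}
    {a a' : ℝ≥0∞} (hc : Tendsto c atTop (𝓝 a)) (hc' : Tendsto c' atTop (𝓝 a'))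
    (h : ∀ ε > 0, ∃ᶠ n : ℕ in atTop, ∃ G : MarkedGraph (Fin n) Ξ Θ,
      levyProkhorovDist G.neighborhoodLaw μ < ε ∧
      c n + ∫⁻ g, F g ∂G.neighborhoodLaw ≤ c' n + ∫⁻ g, F' g ∂G.neighborhoodLaw) :
    a + ∫⁻ g, F g ∂μ ≤ a' + ∫⁻ g, F' g ∂μ := by
  -- For fixed ε, n tends to infinity along the good graphs; replacing U(G) by μ costs ε N on each
  -- side. Only then does ε tend to 0.
  have key : ∀ᶠ ε in 𝓝[>] (0 : ℝ), a + ∫⁻ g, F g ∂μ ≤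
      a' + (∫⁻ g, F' g ∂μ + ENNReal.ofReal ε * N + ENNReal.ofReal ε * N) := by
    filter_upwards [self_mem_nhdsWithin,
      nhdsWithin_le_nhds (Iio_mem_nhds (show (0 : ℝ) < 1 / (1 + (R : ℝ)) by positivity))]
      with ε hε hεR
    refine le_of_tendsto_of_tendsto_of_frequently (hc.add_const _) (hc'.add_const _)
      (((h ε hε).and_eventually (eventually_ge_atTop 1)).mono ?_)
    rintro n ⟨⟨G, hG, hle⟩, hn⟩
    have : NeZero n := ⟨by omega⟩
    have h1 := hF.lintegral_le_add (μ := μ) (ν := G.neighborhoodLaw) hN (le_of_lt hεR)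
      (by rwa [levyProkhorovDist_comm])
    have h2 := hF'.lintegral_le_add (μ := G.neighborhoodLaw) (ν := μ) hN' (le_of_lt hεR) hG
    calc c n + ∫⁻ g, F g ∂μ
        ≤ c n + (∫⁻ g, F g ∂G.neighborhoodLaw + ENNReal.ofReal ε * N) := by gcongr
      _ ≤ c' n + ∫⁻ g, F' g ∂G.neighborhoodLaw + ENNReal.ofReal ε * N := by
        rw [← add_assoc]
        gcongr
      _ ≤ _ := by
        rw [add_assoc]
        gcongr
  have hlim : Tendsto (fun ε : ℝ => a' + (∫⁻ g, F' g ∂μ + ENNReal.ofReal ε * N +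
      ENNReal.ofReal ε * N)) (𝓝[>] 0) (𝓝 (a' + (∫⁻ g, F' g ∂μ + 0 + 0))) := by
    have h0 : Tendsto (fun ε : ℝ => ENNReal.ofReal ε * N) (𝓝[>] 0) (𝓝 0) := by
      have := ENNReal.Tendsto.mul_const (b := (N : ℝ≥0∞))
        ((ENNReal.continuous_ofReal.tendsto 0).mono_left (nhdsWithin_le_nhds (s := Ioi 0)))
        (Or.inr ENNReal.coe_ne_top)
      simpa using this
    exact tendsto_const_nhds.add ((tendsto_const_nhds.add h0).add h0)
  simpa using ge_of_tendsto hlim key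

theorem rootMarkLaw_eq_of_upperBCEntropy_ne_bot [Fintype Θ] {μ : Measure (GStar Ξ Θ)}
    [IsFiniteMeasure μ] {d : Ξ → Ξ → ℝ≥0} {Q : Θ → ℝ≥0} {m : ℕ → Ξ → Ξ → ℕ} {u : ℕ → Θ → ℕ}
    (hmu : IsAdapted m u d Q) (h : upperBCEntropy m u μ ≠ ⊥) (θ : Θ) :
    rootMarkLaw μ θ = Q θ := by
  classical
  have hu : Tendsto (fun n : ℕ => (n : ℝ≥0∞)⁻¹ * u n θ) atTop (𝓝 (Q θ)) := by
    have h1 := ENNReal.tendsto_ofReal (hmu.tendsto_vertex θ)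
    rw [ENNReal.ofReal_coe_nnreal] at h1
    refine h1.congr' ?_
    filter_upwards [eventually_ge_atTop 1] with n hn
    rw [ENNReal.ofReal_div_of_pos (by exact_mod_cast hn), ENNReal.ofReal_natCast,
      ENNReal.ofReal_natCast, mul_comm, div_eq_mul_inv]
  let F : GStar Ξ Θ → ℝ≥0∞ := fun g => if g.rootMark = θ then 1 else 0
  have hF : RootedClass.IsLocal 1 F := GStar.isLocal_rootMark.comp fun t => if t = θ then 1 else 0
  have hF0 : RootedClass.IsLocal 1 (fun _ : GStar Ξ Θ => (0 : ℝ≥0∞)) := fun _ _ _ => rfl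
  have hN : ∀ g, F g ≤ (1 : ℝ≥0) := fun g => by simp only [F]; split_ifs <;> simp
  have hμF : ∫⁻ g, F g ∂μ = rootMarkLaw μ θ := by
    have : F = {g | g.rootMark = θ}.indicator 1 := by
      ext g; simp [F, indicator_apply]
    rw [this, lintegral_indicator_one]
    · rfl
    · exact (RootedClass.IsLocal.isOpen (R := 1) (GStar.isLocal_rootMark.comp (· = θ))).measurableSet
  have hGF : ∀ n, ∀ ε, ∀ G ∈ graphsNear n (m n) (u n) μ ε,
      ∫⁻ g, F g ∂G.neighborhoodLaw = (n : ℝ≥0∞)⁻¹ * u n θ := by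
    intro n ε G hG
    rw [G.lintegral_neighborhoodLaw hF.measurable, Fintype.card_fin, ← hG.1.2]
    congr 1
    change (∑ v, if G.vertexMark v = θ then (1 : ℝ≥0∞) else 0) = _
    rw [Finset.sum_boole, MarkedGraph.vertexMarkCount, ← ncard_coe_finset]
    simp
  rw [← hμF]
  apply le_antisymm
  · have := lintegral_le_of_frequently (μ := μ) hF hF0 hN (by simp) tendsto_const_nhds hu
      (c := 0) (a := 0) fun ε hε => (frequently_graphsNear_nonempty h hε).mono
        fun n ⟨G, hG⟩ => ⟨G, hG.2, by simp [hGF n ε G hG]⟩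
    simpa using this
  · have := lintegral_le_of_frequently (μ := μ) hF0 hF (by simp) hN hu tendsto_const_nhds
      (c' := 0) (a' := 0) fun ε hε => (frequently_graphsNear_nonempty h hε).mono
        fun n ⟨G, hG⟩ => ⟨G, hG.2, by simp [hGF n ε G hG]⟩
    simpa using this

end Entropy

/-! ### Mean mark degrees -/

section Entropy

variable {Ξ Θ : Type*} [Fintype Ξ] [LinearOrder Ξ] [Fintype Θ]

omit [Fintype Ξ] [Fintype Θ] in
theorem sum_markDegree_of_mem_graphsWithCounts {n : ℕ} {m : Ξ → Ξ → ℕ} {u : Θ → ℕ}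
    {G : MarkedGraph (Fin n) Ξ Θ} (hG : G ∈ graphsWithCounts n m u) (x x' : Ξ) :
    ∑ v, G.markDegree x x' v = if x = x' then 2 * m x x' else m x x' := by
  split_ifs with h
  · subst h
    rw [G.sum_markDegree_self, hG.1]
  · rw [G.sum_markDegree_of_ne h, hG.1]

/-- Double counting of edges with two equal marks cancels the 1/2 in the diagonal limit. -/
theorem IsAdapted.tendsto_markDegree {d : Ξ → Ξ → ℝ≥0} {Q : Θ → ℝ≥0} {m : ℕ → Ξ → Ξ → ℕ}
    {u : ℕ → Θ → ℕ} (hmu : IsAdapted m u d Q) (x x' : Ξ) :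
    Tendsto (fun n : ℕ => ((if x = x' then 2 * m n x x' else m n x x' : ℕ) : ℝ) / n) atTop
      (𝓝 (d x x')) := by
  split_ifs with h
  · subst h
    have := (hmu.tendsto_diag x).const_mul 2
    rw [mul_div_cancel₀ _ two_ne_zero] at this
    refine this.congr fun n => ?_
    push_cast
    ring
  · exact hmu.tendsto_offDiag x x' h

theorem IsAdapted.exists_edgeNorm_le {d : Ξ → Ξ → ℝ≥0} {Q : Θ → ℝ≥0} {m : ℕ → Ξ → Ξ → ℕ}
    {u : ℕ → Θ → ℕ} (hmu : IsAdapted m u d Q) :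
    ∃ D : ℝ, 0 ≤ D ∧ ∀ᶠ n : ℕ in atTop, (edgeNorm (m n) : ℝ) ≤ D * n := by
  have h : Tendsto (fun n : ℕ => ∑ x, ∑ x',
      ((if x = x' then 2 * m n x x' else m n x x' : ℕ) : ℝ) / n) atTop
      (𝓝 (∑ x, ∑ x', (d x x' : ℝ))) :=
    tendsto_finsetSum _ fun x _ => tendsto_finsetSum _ fun x' _ => hmu.tendsto_markDegree x x'
  have h0 : 0 ≤ ∑ x, ∑ x', (d x x' : ℝ) :=
    Finset.sum_nonneg fun x _ => Finset.sum_nonneg fun x' _ => NNReal.coe_nonneg _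
  refine ⟨(∑ x, ∑ x', (d x x' : ℝ)) + 1, by positivity, ?_⟩
  filter_upwards [h.eventually_le_const (lt_add_one _), eventually_ge_atTop 1] with n hn hn1
  have hn0 : (0 : ℝ) < n := by exact_mod_cast hn1
  rw [← div_le_iff₀ hn0]
  refine le_trans ?_ hn
  rw [edgeNorm]
  push_cast
  simp only [Finset.sum_div]
  refine Finset.sum_le_sum fun x _ => Finset.sum_le_sum fun x' _ => ?_
  gcongr
  split_ifs <;> linarith [Nat.cast_nonneg (α := ℝ) (m n x x')]

/-- Truncation at K gives a bounded local function whose averages are at most those of the degree;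
monotone convergence then removes K. -/
theorem meanMarkDegree_le_of_upperBCEntropy_ne_bot {μ : Measure (GStar Ξ Θ)}
    [IsFiniteMeasure μ] {d : Ξ → Ξ → ℝ≥0} {Q : Θ → ℝ≥0} {m : ℕ → Ξ → Ξ → ℕ} {u : ℕ → Θ → ℕ}
    (hmu : IsAdapted m u d Q) (h : upperBCEntropy m u μ ≠ ⊥) (x x' : Ξ) :
    meanMarkDegree μ x x' ≤ d x x' := by
  have hc : Tendsto (fun n : ℕ => (n : ℝ≥0∞)⁻¹ *
      (if x = x' then 2 * m n x x' else m n x x' : ℕ)) atTop (𝓝 (d x x')) := by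
    have h1 := ENNReal.tendsto_ofReal (hmu.tendsto_markDegree x x')
    rw [ENNReal.ofReal_coe_nnreal] at h1
    refine h1.congr' ?_
    filter_upwards [eventually_ge_atTop 1] with n hn
    rw [ENNReal.ofReal_div_of_pos (by exact_mod_cast hn), ENNReal.ofReal_natCast,
      ENNReal.ofReal_natCast, ENNReal.div_eq_inv_mul]
  let F : ℕ → GStar Ξ Θ → ℝ≥0∞ := fun K g => (min (g.markDegree x x') K : ℕ)
  have hF : ∀ K, RootedClass.IsLocal 1 (F K) := fun K =>
    (GStar.isLocal_markDegree x x').comp fun t => ((min t K : ℕ) : ℝ≥0∞)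
  have hFK : ∀ K, ∫⁻ g, F K g ∂μ ≤ d x x' := by
    intro K
    have := lintegral_le_of_frequently (μ := μ) (N := K) (hF K) (F' := fun _ => 0)
      (fun _ _ _ => rfl) (fun g => by simp [F]) (by simp) tendsto_const_nhds hc (c := 0) (a := 0)
      fun ε hε => (frequently_graphsNear_nonempty h hε).mono fun n ⟨G, hG⟩ => ⟨G, hG.2, by
        rw [G.lintegral_neighborhoodLaw (hF K).measurable, Fintype.card_fin,
          ← sum_markDegree_of_mem_graphsWithCounts hG.1]
        simp only [lintegral_zero, add_zero, Pi.zero_apply, zero_add, Nat.cast_sum]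
        gcongr with v
        simp only [F, MarkedGraph.markDegree_rootedClass]
        exact Nat.cast_le.2 (min_le_left _ _)⟩
    simpa using this
  have hsup : ∀ g : GStar Ξ Θ, (g.markDegree x x' : ℝ≥0∞) = ⨆ K, F K g := fun g => by
    refine le_antisymm (le_iSup_of_le (g.markDegree x x') (by simp [F])) (iSup_le fun K => ?_)
    simp only [F]
    exact_mod_cast min_le_left _ _
  rw [meanMarkDegree]
  simp only [hsup]
  rw [lintegral_iSup (fun K => (hF K).measurable) fun K L hKL g => by
    simp only [F]
    exact_mod_cast min_le_min le_rfl hKL]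
  exact iSup_le hFK

/-- Closeness to μ bounds the truncated degree sum by (b + δ)n, while the mark counts force the full
sum to be at least (b + 2δ)n. The missing δn sits at vertices of mark degree above K, of which there
are at most 2‖m‖₁/K. -/
theorem ncard_graphsNear_le {n : ℕ} (hn : 1 ≤ n) {m : Ξ → Ξ → ℕ} {u : Θ → ℕ}
    {μ : Measure (GStar Ξ Θ)} [IsFiniteMeasure μ] {x x' : Ξ} {K : ℕ} (hK : 1 ≤ K) {ε δ b D : ℝ}
    (hε : ε ≤ 1 / 2) (hμ : ∫⁻ g, (g.markDegree x x' : ℝ≥0∞) ∂μ ≤ ENNReal.ofReal b) (hb : 0 ≤ b)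
    (hεK : ε * K ≤ δ)
    (hm : (b + 2 * δ) * n ≤ (if x = x' then 2 * m x x' else m x x' : ℕ))
    (hD : (edgeNorm m : ℝ) ≤ D * n) (hδ : 0 ≤ δ) :
    ((graphsNear n m u μ ε).ncard : ℝ) ≤ (n : ℝ) ^ edgeNorm m *
      Real.exp ((Fintype.card Θ + 1 + (Fintype.card Ξ : ℝ) ^ 2 * (1 + 2 * D) ^ 2
        - δ * Real.log K) * n) := by
  classical
  have hn0 : (0 : ℝ) < n := by exact_mod_cast hn
  have hK0 : (0 : ℝ) < K := by exact_mod_cast hK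
  have : NeZero n := ⟨by omega⟩
  have hfin : (graphsNear n m u μ ε).Finite := toFinite _
  rw [ncard_eq_toFinset_card _ hfin]
  refine (MarkedGraph.card_le_of_forall_exists_sum_degree (M := edgeNorm m) _ hK (t := δ * n)
    (fun G hG => ?_) (fun G hG => ?_)).trans ?_
  · rw [((hfin.mem_toFinset).1 hG).1.1]
  · have hG := (hfin.mem_toFinset).1 hG
    refine ⟨Finset.univ.filter fun v => K < G.markDegree x x' v, ?_, ?_⟩
    · refine le_trans ?_ ((G.sum_degree_le_two_mul
        (Finset.univ.filter fun v => K < G.markDegree x x' v)).trans_eq (by rw [hG.1.1]))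
      rw [mul_comm, ← smul_eq_mul]
      refine Finset.card_nsmul_le_sum _ G.degree _ fun v hv => ?_
      exact (Finset.mem_filter.1 hv).2.le.trans (G.markDegree_le_degree _ _ _)
    · let F : GStar Ξ Θ → ℝ≥0∞ := fun g => (min (g.markDegree x x') K : ℕ)
      have hF : RootedClass.IsLocal 1 F :=
        (GStar.isLocal_markDegree x x').comp fun t => ((min t K : ℕ) : ℝ≥0∞)
      -- The hypothesis ε ≤ 1/2 is the threshold 1/(1+R) for R = 1.
      have h1 := hF.lintegral_le_add (N := K) (fun g => by simp [F]) (by norm_num; linarith) hG.2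
      have h2 : ∫⁻ g, F g ∂G.neighborhoodLaw ≤ ENNReal.ofReal (b + δ) := by
        refine h1.trans ?_
        rw [ENNReal.ofReal_add hb hδ]
        gcongr
        · refine le_trans (lintegral_mono fun g => ?_) hμ
          simp only [F]
          exact_mod_cast min_le_left _ _
        · refine le_trans (le_of_eq ?_) (ENNReal.ofReal_le_ofReal hεK)
          rw [ENNReal.ofReal_mul' hK0.le]
          simp
      rw [G.lintegral_neighborhoodLaw hF.measurable, Fintype.card_fin, mul_comm, ← div_eq_mul_inv,
        ENNReal.div_le_iff (by positivity) (by simp)] at h2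
      have h3 : ((∑ v, min (G.markDegree x x' v) K : ℕ) : ℝ) ≤ (b + δ) * n := by
        have h4 : ENNReal.ofReal (∑ v, min (G.markDegree x x' v) K : ℕ) ≤
            ENNReal.ofReal ((b + δ) * n) := by
          rw [ENNReal.ofReal_mul (by positivity), ENNReal.ofReal_natCast, ENNReal.ofReal_natCast]
          simpa only [F, MarkedGraph.markDegree_rootedClass, Nat.cast_sum] using h2
        exact (ENNReal.ofReal_le_ofReal_iff (by positivity)).1 h4
      have h5 : ∑ v, G.markDegree x x' v ≤ ∑ v, min (G.markDegree x x' v) K +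
          ∑ v with K < G.markDegree x x' v, G.degree v := by
        rw [Finset.sum_filter, ← Finset.sum_add_distrib]
        refine Finset.sum_le_sum fun v _ => ?_
        have := G.markDegree_le_degree x x' v
        split_ifs <;> omega
      rw [sum_markDegree_of_mem_graphsWithCounts hG.1] at h5
      have h6 := hm.trans (Nat.cast_le.2 h5)
      rw [Nat.cast_add] at h6
      linarith
  · rw [Fintype.card_fin, mul_assoc]
    gcongr
    have e1 : (Fintype.card Θ : ℝ) ^ n ≤ Real.exp (Fintype.card Θ * n) := by
      rw [mul_comm, Real.exp_nat_mul]
      gcongr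
      linarith [Real.add_one_le_exp (Fintype.card Θ : ℝ)]
    have e2 : (2 : ℝ) ^ n ≤ Real.exp n := by
      rw [← mul_one (n : ℝ), Real.exp_nat_mul]
      gcongr
      linarith [Real.add_one_le_exp 1]
    have e3 : ((K : ℝ) ^ (δ * n))⁻¹ = Real.exp (-(δ * Real.log K * n)) := by
      rw [Real.rpow_def_of_pos hK0, ← Real.exp_neg]
      ring_nf
    have e4 : (Fintype.card Ξ : ℝ) ^ 2 * (n + 2 * edgeNorm m) ^ 2 * (n : ℝ)⁻¹ ≤
        (Fintype.card Ξ : ℝ) ^ 2 * (1 + 2 * D) ^ 2 * n := by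
      calc _ ≤ (Fintype.card Ξ : ℝ) ^ 2 * (n + 2 * (D * n)) ^ 2 * (n : ℝ)⁻¹ := by gcongr
        _ = _ := by field_simp
    calc _ ≤ Real.exp (-(δ * Real.log K * n)) * (Real.exp (Fintype.card Θ * n) * Real.exp n *
          Real.exp ((Fintype.card Ξ : ℝ) ^ 2 * (1 + 2 * D) ^ 2 * n)) := by
          rw [e3]
          gcongr
      _ = _ := by
          rw [← Real.exp_add, ← Real.exp_add, ← Real.exp_add]
          ring_nf

theorem le_meanMarkDegree_of_upperBCEntropy_ne_bot {μ : Measure (GStar Ξ Θ)}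
    [IsFiniteMeasure μ] {d : Ξ → Ξ → ℝ≥0} {Q : Θ → ℝ≥0} {m : ℕ → Ξ → Ξ → ℕ} {u : ℕ → Θ → ℕ}
    (hmu : IsAdapted m u d Q) (h : upperBCEntropy m u μ ≠ ⊥) (x x' : Ξ) :
    (d x x' : ℝ≥0∞) ≤ meanMarkDegree μ x x' := by
  by_contra! hlt
  refine h (upperBCEntropy_eq_bot_of_forall_ncard_le fun C => ?_)
  obtain ⟨b, hb⟩ : ∃ b : ℝ≥0, meanMarkDegree μ x x' = b :=
    ⟨_, (ENNReal.coe_toNNReal (hlt.trans_le le_top).ne).symm⟩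
  rw [hb, ENNReal.coe_lt_coe] at hlt
  have hlt' : (b : ℝ) < d x x' := hlt
  -- One δ absorbs the truncated approximation error εK, the other is the excess degree per vertex.
  obtain ⟨δ, hδ, hbδ⟩ : ∃ δ : ℝ, 0 < δ ∧ b + 2 * δ < d x x' :=
    ⟨(d x x' - b) / 4, by linarith, by linarith⟩
  obtain ⟨D, -, hD⟩ := hmu.exists_edgeNorm_le
  have hlog : Tendsto (fun K : ℕ => Fintype.card Θ + 1 + (Fintype.card Ξ : ℝ) ^ 2 *
      (1 + 2 * D) ^ 2 - δ * Real.log K) atTop atBot := by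
    refine tendsto_atBot_add_const_left _ _ ?_ |>.congr fun K => (sub_eq_add_neg _ _).symm
    exact tendsto_neg_atTop_atBot.comp
      ((Real.tendsto_log_atTop.comp tendsto_natCast_atTop_atTop).const_mul_atTop hδ)
  -- K is fixed before ε, since ε must be at most δ/K; the constant in front of -δ log K depends on
  -- neither.
  obtain ⟨K, hKC, hK⟩ := ((hlog.eventually_le_atBot C).and (eventually_ge_atTop 1)).exists
  have hK0 : (0 : ℝ) < K := by exact_mod_cast hK
  refine ⟨min (1 / 2) (δ / K), by positivity, ?_⟩
  filter_upwards [hD, eventually_ge_atTop 1,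
    (hmu.tendsto_markDegree x x').eventually_const_le hbδ] with n hD hn hm
  have hn0 : (0 : ℝ) < n := by exact_mod_cast hn
  refine (ncard_graphsNear_le hn hK (b := b) (min_le_left _ _) ?_ b.2 ?_ ((le_div_iff₀ hn0).1 hm)
    hD hδ.le).trans ?_
  · rw [ENNReal.ofReal_coe_nnreal, ← hb, meanMarkDegree]
  · exact (le_div_iff₀ hK0).1 (min_le_right _ _)
  · gcongr

end Entropy

/-! ### Finite balls and cylinder sets -/

namespace MarkedGraph

variable {V W Ξ Θ : Type*}

/-- Relabelling the vertices of a marked graph. -/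
def relabel (G : MarkedGraph V Ξ Θ) (e : V ≃ W) : MarkedGraph W Ξ Θ where
  graph := G.graph.comap e.symm
  edgeMark v w := G.edgeMark (e.symm v) (e.symm w)
  vertexMark v := G.vertexMark (e.symm v)
  isSome_edgeMark_iff _ _ := G.isSome_edgeMark_iff _ _
  locallyFinite v := (G.locallyFinite (e.symm v)).preimage e.symm.injective.injOn

theorem rootedIso_relabel {k : ℕ} (G : MarkedGraph V Ξ Θ) (r : Fin k → V) (e : V ≃ W) :
    G.RootedIso r (G.relabel e) (fun i => e (r i)) :=
  ⟨e, fun _ => rfl, fun v w => by simp [relabel], fun v => by simp [relabel]⟩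

end MarkedGraph

namespace RootedMarkedGraph

variable {Ξ Θ : Type*} {k : ℕ}

theorem finite_ball (a : RootedMarkedGraph Ξ Θ k) (h : ℕ) : (a.ball h).Finite := by
  induction h with
  | zero =>
    refine (finite_range a.root).subset fun v ⟨i, hi⟩ => ⟨i, ?_⟩
    exact (a.connected (a.root i) v).dist_eq_zero_iff.1 (Nat.le_zero.1 hi)
  | succ h ih =>
    refine (ih.union (ih.biUnion fun v _ => a.G.locallyFinite v)).subset fun v ⟨i, hi⟩ => ?_
    obtain ⟨p, hp⟩ := a.connected.exists_walk_length_eq_dist v (a.root i)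
    rw [SimpleGraph.dist_comm, ← hp] at hi
    cases p with
    | nil => exact Or.inl (a.root_mem_ball h i)
    | @cons _ w _ hvw q =>
      refine Or.inr (mem_biUnion (x := w) ⟨i, ?_⟩ hvw.symm)
      rw [SimpleGraph.dist_comm]
      have := SimpleGraph.dist_le q
      simp only [SimpleGraph.Walk.length_cons] at hi
      omega

/-- The graph `a` with two new distinguished vertices. -/
abbrev withRoots (a : RootedMarkedGraph Ξ Θ k) (v w : a.V) : RootedMarkedGraph Ξ Θ 2 :=
  ⟨a.V, a.countable, a.G, a.connected, ![v, w]⟩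

/-- A geodesic of length at most h from the first root stays inside the ball, so the isomorphism
carries it along. -/
theorem dist_root_le_of_ballIso {a b : RootedMarkedGraph Ξ Θ 2} {h : ℕ} (hab : BallIso h a b)
    (ha : a.G.graph.dist (a.root 0) (a.root 1) ≤ h) :
    b.G.graph.dist (b.root 0) (b.root 1) ≤ h := by
  obtain ⟨e, h1, h2, h3⟩ := hab
  let a' : RootedMarkedGraph Ξ Θ 1 := ⟨a.V, a.countable, a.G, a.connected, fun _ => a.root 0⟩
  let b' : RootedMarkedGraph Ξ Θ 1 := ⟨b.V, b.countable, b.G, b.connected, fun _ => b.root 0⟩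
  have hsub : a'.ball h ⊆ a.ball h := fun v ⟨_, hv⟩ => ⟨0, hv⟩
  have := mem_ball_map (a := a') (b := b') (S := a.ball h) (T := b.ball h) e
    (fun i _ => congrArg Subtype.val (h1 0)) (fun v w hvw => by
      have h4 : b.G.edgeMark (e v) (e w) = a.G.edgeMark v w := h2 v w
      have h5 : a.G.graph.Adj v w := hvw
      change b.G.graph.Adj (e v) (e w)
      rwa [← b.G.isSome_edgeMark_iff, h4, a.G.isSome_edgeMark_iff]) h hsub (a.root 1) ⟨0, ha⟩
  obtain ⟨_, hi⟩ := this
  have h6 : ((e ⟨a.root 1, hsub ⟨0, ha⟩⟩ : b.ball h) : b.V) = b.root 1 :=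
    congrArg Subtype.val (h1 1)
  rwa [h6] at hi

/-- An isomorphism of balls of radius `2R` restricts to an isomorphism of the balls of radius `R`
about two vertices at distance at most `R` from the root. -/
theorem exists_equiv_of_ballIso {a b : RootedMarkedGraph Ξ Θ 1} {R : ℕ}
    (hab : BallIso (2 * R) a b) : ∃ e : a.ball (2 * R) ≃ b.ball (2 * R),
      (e ⟨a.root 0, a.root_mem_ball _ 0⟩ : b.V) = b.root 0 ∧
      (∀ v, (e v : b.V) ∈ b.ball R ↔ (v : a.V) ∈ a.ball R) ∧
      ∀ v w : a.ball (2 * R), (v : a.V) ∈ a.ball R → (w : a.V) ∈ a.ball R →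
        BallIso R (a.withRoots v w) (b.withRoots (e v) (e w)) := by
  obtain ⟨e, h1, h2, h3⟩ := hab
  have hadj : ∀ v w, b.G.graph.Adj (e v) (e w) ↔ a.G.graph.Adj v w := fun v w => by
    rw [← b.G.isSome_edgeMark_iff, ← a.G.isSome_edgeMark_iff]
    have : b.G.edgeMark (e v) (e w) = a.G.edgeMark v w := h2 v w
    rw [this]
  have hle : R ≤ 2 * R := by omega
  have hfwd := mem_ball_map (a := a) (b := b) e
    (fun i _ => congrArg Subtype.val (h1 i)) (fun v w => (hadj v w).2) R (a.ball_mono hle)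
  have hbwd := mem_ball_map (a := b) (b := a) e.symm
    (fun i _ => by
      have : e.symm _ = _ := (Equiv.symm_apply_eq e).2 (h1 i).symm
      exact congrArg Subtype.val this)
    (fun v w hvw => by
      rw [← hadj]; simpa using hvw) R (b.ball_mono hle)
  -- The triangle inequality here is the reason for the radius 2R.
  have hsub : ∀ (c : RootedMarkedGraph Ξ Θ 1) (v w : c.V), v ∈ c.ball R → w ∈ c.ball R →
      (c.withRoots v w).ball R ⊆ c.ball (2 * R) := by
    intro c v w ⟨i, hv⟩ ⟨j, hw⟩ z ⟨l, hz⟩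
    fin_cases l
    · refine ⟨i, (c.connected.dist_triangle (v := v)).trans ?_⟩
      have : c.G.graph.dist v z ≤ R := hz
      omega
    · refine ⟨j, (c.connected.dist_triangle (v := w)).trans ?_⟩
      have : c.G.graph.dist w z ≤ R := hz
      omega
  refine ⟨e, congrArg Subtype.val (h1 0), fun v => ⟨fun hv => ?_, fun hv => hfwd v hv⟩,
    fun v w hv hw => ?_⟩
  · simpa using hbwd _ hv
  · refine ballIso_of_induce (hsub a v w hv hw) (hsub b _ _ (hfwd v hv) (hfwd w hw))
      ⟨e, fun i => ?_, h2, h3⟩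
    fin_cases i <;> rfl

end RootedMarkedGraph

namespace RootedClass

variable {Ξ Θ : Type*} {k : ℕ}

/-- Finite marked graphs with `k` distinguished vertices, as codes of balls of radius `h`. -/
abbrev BallCode (Ξ Θ : Type*) (k : ℕ) :=
  ℕ × (Σ n : ℕ, MarkedGraph (Fin n) Ξ Θ × (Fin k → Fin n))

/-- The classes whose ball of radius `c.1` about the distinguished vertices is the graph coded
by `c`. -/
def cylinder (c : BallCode Ξ Θ k) : Set (RootedClass Ξ Θ k) :=
  {g | Quotient.lift (fun a : RootedMarkedGraph Ξ Θ k => (a.G.induce (a.ball c.1)).RootedIso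
    (fun i => ⟨a.root i, a.root_mem_ball c.1 i⟩) c.2.2.1 c.2.2.2)
    (fun _ _ h => propext ⟨fun H => (h.ballIso c.1).symm.trans H,
      fun H => (h.ballIso c.1).trans H⟩) g}

theorem mk_mem_cylinder {c : BallCode Ξ Θ k} {a : RootedMarkedGraph Ξ Θ k} :
    (Quotient.mk _ a : RootedClass Ξ Θ k) ∈ cylinder c ↔ (a.G.induce (a.ball c.1)).RootedIso
      (fun i => ⟨a.root i, a.root_mem_ball c.1 i⟩) c.2.2.1 c.2.2.2 := Iff.rfl

theorem isLocal_cylinder (c : BallCode Ξ Θ k) : IsLocal c.1 (· ∈ cylinder c) := fun _ _ h =>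
  propext ⟨fun H => h.symm.trans (mk_mem_cylinder.1 H), fun H => h.trans (mk_mem_cylinder.1 H)⟩

theorem ballIso_of_mem_cylinder {c : BallCode Ξ Θ k} {a b : RootedMarkedGraph Ξ Θ k}
    (ha : (Quotient.mk _ a : RootedClass Ξ Θ k) ∈ cylinder c)
    (hb : (Quotient.mk _ b : RootedClass Ξ Θ k) ∈ cylinder c) : a.BallIso c.1 b :=
  (mk_mem_cylinder.1 ha).trans (mk_mem_cylinder.1 hb).symm

theorem ncard_ball_of_mem_cylinder {c : BallCode Ξ Θ k} {a : RootedMarkedGraph Ξ Θ k}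
    (ha : (Quotient.mk _ a : RootedClass Ξ Θ k) ∈ cylinder c) : (a.ball c.1).ncard = c.2.1 := by
  obtain ⟨e, -⟩ := mk_mem_cylinder.1 ha
  rw [← Nat.card_coe_set_eq, Nat.card_congr e, Nat.card_fin]

theorem exists_mem_cylinder (g : RootedClass Ξ Θ k) (h : ℕ) :
    ∃ c : BallCode Ξ Θ k, c.1 = h ∧ g ∈ cylinder c := by
  induction g using Quotient.inductionOn with | _ a
  have : Finite (a.ball h) := a.finite_ball h
  let e := Finite.equivFin (a.ball h)
  exact ⟨⟨h, _, (a.G.induce (a.ball h)).relabel e, fun i => e ⟨a.root i, a.root_mem_ball h i⟩⟩, rfl,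
    mk_mem_cylinder.2 (MarkedGraph.rootedIso_relabel _ _ e)⟩

/-- Two cylinders are nested or disjoint, since the ball of larger radius determines the smaller
one. -/
theorem isPiSystem_range_cylinder :
    IsPiSystem (range (cylinder : BallCode Ξ Θ k → Set (RootedClass Ξ Θ k))) := by
  have key : ∀ c c' : BallCode Ξ Θ k, c.1 ≤ c'.1 → (cylinder c ∩ cylinder c').Nonempty →
      cylinder c' ⊆ cylinder c := by
    rintro c c' hle ⟨g, hg, hg'⟩ g₁ hg₁
    induction g using Quotient.inductionOn with | _ a
    induction g₁ using Quotient.inductionOn with | _ b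
    exact (isLocal_cylinder c a b ((ballIso_of_mem_cylinder hg' hg₁).mono hle)).mp hg
  rintro _ ⟨c, rfl⟩ _ ⟨c', rfl⟩ hne
  rcases le_total c.1 c'.1 with hle | hle
  · exact ⟨c', (inter_eq_right.2 (key c c' hle hne)).symm⟩
  · exact ⟨c, (inter_eq_left.2 (key c' c hle (by rwa [inter_comm]))).symm⟩

/-- An open set is the union of the cylinders inside it, and finiteness of the mark sets leaves only
countably many codes. -/
theorem borel_eq_generateFrom_cylinder [Finite Ξ] [Finite Θ] :
    (inferInstance : MeasurableSpace (RootedClass Ξ Θ k)) =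
      MeasurableSpace.generateFrom (range cylinder) := by
  refine le_antisymm (MeasurableSpace.generateFrom_le fun U (hU : IsOpen U) => ?_)
    (MeasurableSpace.generateFrom_le ?_)
  · have hU' : U = ⋃ c ∈ {c : BallCode Ξ Θ k | cylinder c ⊆ U}, cylinder c := by
      refine Subset.antisymm (fun g hg => ?_) (iUnion₂_subset fun c hc => hc)
      obtain ⟨ε, hε, hball⟩ := Metric.isOpen_iff.1 hU g hg
      obtain ⟨R, hR⟩ := exists_nat_one_div_lt hε
      obtain ⟨c, hc, hgc⟩ := exists_mem_cylinder g R
      refine mem_biUnion (x := c) (fun g' hg' => hball ?_) hgc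
      induction g using Quotient.inductionOn with | _ a
      induction g' using Quotient.inductionOn with | _ b
      have := (ballIso_of_mem_cylinder hg' hgc).localDist_le
      rw [hc, add_comm] at this
      exact Metric.mem_ball.2 (lt_of_le_of_lt this hR)
    rw [hU']
    exact MeasurableSet.biUnion (to_countable _) fun c _ =>
      MeasurableSpace.measurableSet_generateFrom ⟨c, rfl⟩
  · rintro _ ⟨c, rfl⟩
    exact (isLocal_cylinder c).isOpen.measurableSet

end RootedClass

/-! ### The two sides of mass transport as measures on doubly rooted graphs -/

namespace GStar

open RootedClass RootedMarkedGraph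

variable {Ξ Θ : Type*}

/-- A representative of a class of rooted marked graphs. -/
noncomputable def rep (g : GStar Ξ Θ) : RootedMarkedGraph Ξ Θ 1 :=
  Quotient.out (s := RootedMarkedGraph.setoid Ξ Θ 1) g

theorem mk_rep (g : GStar Ξ Θ) : Quotient.mk _ g.rep = g :=
  Quotient.out_eq (s := RootedMarkedGraph.setoid Ξ Θ 1) g

/-- The measure `∑_v δ_{[G, o, v]}`. -/
noncomputable def measureFrom (g : GStar Ξ Θ) : Measure (GStarStar Ξ Θ) :=
  Measure.sum fun v : g.rep.V => Measure.dirac (g.rep.pairClass (g.rep.root 0) v)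

/-- The measure `∑_v δ_{[G, v, o]}`. -/
noncomputable def measureTo (g : GStar Ξ Θ) : Measure (GStarStar Ξ Θ) :=
  Measure.sum fun v : g.rep.V => Measure.dirac (g.rep.pairClass v (g.rep.root 0))

theorem lintegral_measureFrom {f : GStarStar Ξ Θ → ℝ≥0} (hf : Measurable f) (g : GStar Ξ Θ) :
    ∫⁻ p, f p ∂measureFrom g = sumFrom f g := by
  rw [measureFrom, lintegral_sum_measure]
  conv_rhs => rw [← mk_rep g]
  exact tsum_congr fun v => lintegral_dirac' _ (measurable_coe_nnreal_ennreal.comp hf)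

theorem lintegral_measureTo {f : GStarStar Ξ Θ → ℝ≥0} (hf : Measurable f) (g : GStar Ξ Θ) :
    ∫⁻ p, f p ∂measureTo g = sumTo f g := by
  rw [measureTo, lintegral_sum_measure]
  conv_rhs => rw [← mk_rep g]
  exact tsum_congr fun v => lintegral_dirac' _ (measurable_coe_nnreal_ennreal.comp hf)

theorem measureFrom_apply {E : Set (GStarStar Ξ Θ)} (hE : MeasurableSet E) (g : GStar Ξ Θ) :
    measureFrom g E = sumFrom (E.indicator 1) g := by
  rw [← lintegral_measureFrom (measurable_one.indicator hE), ← lintegral_indicator_one hE]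
  refine lintegral_congr fun p => ?_
  by_cases hp : p ∈ E <;> simp [hp]

theorem measureTo_apply {E : Set (GStarStar Ξ Θ)} (hE : MeasurableSet E) (g : GStar Ξ Θ) :
    measureTo g E = sumTo (E.indicator 1) g := by
  rw [← lintegral_measureTo (measurable_one.indicator hE), ← lintegral_indicator_one hE]
  refine lintegral_congr fun p => ?_
  by_cases hp : p ∈ E <;> simp [hp]

/-- The classes `[G, v, w]` with `dist(v, w) ≤ h` whose ball of radius `h` about `v, w` has at
most `N` vertices. -/
def nearPairs (Ξ Θ : Type*) (h N : ℕ) : Set (GStarStar Ξ Θ) :=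
  {p | ∀ a : RootedMarkedGraph Ξ Θ 2, Quotient.mk _ a = p →
    a.G.graph.dist (a.root 0) (a.root 1) ≤ h ∧ (a.ball h).ncard ≤ N}

theorem tsum_indicator_le {a : RootedMarkedGraph Ξ Θ 1} {h N : ℕ} {E : Set (GStarStar Ξ Θ)}
    {P : a.V → GStarStar Ξ Θ} (hP : ∀ v, P v ∈ E → v ∈ a.ball h ∧ (a.ball h).ncard ≤ N) :
    ∑' v, ((E.indicator 1 (P v) : ℝ≥0) : ℝ≥0∞) ≤ (N : ℝ≥0) := by
  -- The bound on the size of the ball is available only from a vertex with `P v ∈ E`; without one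
  -- the sum vanishes.
  by_cases hne : ∃ v, P v ∈ E
  · obtain ⟨v₀, hv₀⟩ := hne
    rw [tsum_eq_sum (s := (a.finite_ball h).toFinset) fun v hv => by
      rw [indicator_of_notMem fun hv' => hv ((a.finite_ball h).mem_toFinset.2 (hP v hv').1)]
      rfl]
    refine (Finset.sum_le_card_nsmul _ _ 1 fun v _ => ?_).trans ?_
    · by_cases hv : P v ∈ E <;> simp [hv]
    · rw [← ncard_eq_toFinset_card _ (a.finite_ball h)]
      simpa using (hP v₀ hv₀).2
  · push Not at hne
    simp [hne]

theorem tsum_eq_of_equiv {V W : Type*} {S : Set V} {T : Set W} (e : S ≃ T) {F : V → ℝ≥0∞}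
    {F' : W → ℝ≥0∞} (hF : Function.support F ⊆ S) (hF' : Function.support F' ⊆ T)
    (h : ∀ v : S, F' (e v) = F v) : ∑' v, F v = ∑' w, F' w := by
  rw [← tsum_subtype_eq_of_support_subset hF, ← tsum_subtype_eq_of_support_subset hF',
    ← e.tsum_eq]
  exact tsum_congr fun v => (h v).symm

section

variable {E : Set (GStarStar Ξ Θ)} {h N : ℕ}

theorem mem_ball_of_pairClass_mem (hE : E ⊆ nearPairs Ξ Θ h N) {a : RootedMarkedGraph Ξ Θ 1}
    {v : a.V} (hv : a.pairClass (a.root 0) v ∈ E) : v ∈ a.ball h ∧ (a.ball h).ncard ≤ N := by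
  have := hE hv (a.withRoots (a.root 0) v) rfl
  refine ⟨⟨0, this.1⟩, (ncard_le_ncard ?_ (finite_ball (a.withRoots (a.root 0) v) h)).trans this.2⟩
  rintro w ⟨i, hw⟩
  rw [Subsingleton.elim i 0] at hw
  exact ⟨0, hw⟩

theorem mem_ball_of_pairClass_mem' (hE : E ⊆ nearPairs Ξ Θ h N) {a : RootedMarkedGraph Ξ Θ 1}
    {v : a.V} (hv : a.pairClass v (a.root 0) ∈ E) : v ∈ a.ball h ∧ (a.ball h).ncard ≤ N := by
  have := hE hv (a.withRoots v (a.root 0)) rfl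
  refine ⟨⟨0, ?_⟩, (ncard_le_ncard ?_ (finite_ball (a.withRoots v (a.root 0)) h)).trans this.2⟩
  · rw [SimpleGraph.dist_comm]
    exact this.1
  · rintro w ⟨i, hw⟩
    rw [Subsingleton.elim i 0] at hw
    exact ⟨1, hw⟩

theorem sumFrom_indicator_le (hE : E ⊆ nearPairs Ξ Θ h N) (g : GStar Ξ Θ) :
    sumFrom (E.indicator 1) g ≤ (N : ℝ≥0) := by
  induction g using Quotient.inductionOn with | _ a
  exact tsum_indicator_le fun v hv => mem_ball_of_pairClass_mem hE hv

theorem sumTo_indicator_le (hE : E ⊆ nearPairs Ξ Θ h N) (g : GStar Ξ Θ) :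
    sumTo (E.indicator 1) g ≤ (N : ℝ≥0) := by
  induction g using Quotient.inductionOn with | _ a
  exact tsum_indicator_le fun v hv => mem_ball_of_pairClass_mem' hE hv

theorem indicator_one_congr {p q : GStarStar Ξ Θ} (h : p ∈ E ↔ q ∈ E) :
    ((E.indicator 1 p : ℝ≥0) : ℝ≥0∞) = (E.indicator 1 q : ℝ≥0) := by
  by_cases hq : q ∈ E
  · rw [indicator_of_mem (h.2 hq), indicator_of_mem hq]; rfl
  · rw [indicator_of_notMem (mt h.1 hq), indicator_of_notMem hq]

theorem mem_of_indicator_ne_zero {p : GStarStar Ξ Θ}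
    (h : ((E.indicator 1 p : ℝ≥0) : ℝ≥0∞) ≠ 0) : p ∈ E := by
  by_contra hp
  exact h (by rw [indicator_of_notMem hp]; rfl)

variable {R : ℕ}

/-- Only vertices v within distance R of the root contribute, and the R-ball about the pair (o, v)
lies in the 2R-ball about o. An isomorphism of 2R-balls therefore matches the contributing vertices.
-/
theorem isLocal_sumFrom (hE : E ⊆ nearPairs Ξ Θ h N) (hloc : IsLocal R (· ∈ E)) (hR : h ≤ R) :
    IsLocal (2 * R) (sumFrom (E.indicator 1)) := by
  intro a b hab
  obtain ⟨e, he, hball, hiso⟩ := exists_equiv_of_ballIso hab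
  have hsupp : ∀ (c : RootedMarkedGraph Ξ Θ 1) (v : c.V),
      c.pairClass (c.root 0) v ∈ E → v ∈ c.ball R := fun c v hv =>
    c.ball_mono hR (mem_ball_of_pairClass_mem hE hv).1
  refine tsum_eq_of_equiv e
    (fun v hv => a.ball_mono (by omega) (hsupp a v (mem_of_indicator_ne_zero hv)))
    (fun v hv => b.ball_mono (by omega) (hsupp b v (mem_of_indicator_ne_zero hv)))
    fun v => indicator_one_congr ?_
  by_cases hv : (v : a.V) ∈ a.ball R
  · have := hloc _ _ (hiso ⟨a.root 0, a.root_mem_ball _ 0⟩ v (a.root_mem_ball R 0) hv)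
    rw [he] at this
    exact Iff.of_eq this.symm
  · exact iff_of_false (fun h' => hv ((hball v).1 (hsupp b _ h'))) fun h' => hv (hsupp a _ h')

theorem isLocal_sumTo (hE : E ⊆ nearPairs Ξ Θ h N) (hloc : IsLocal R (· ∈ E)) (hR : h ≤ R) :
    IsLocal (2 * R) (sumTo (E.indicator 1)) := by
  intro a b hab
  obtain ⟨e, he, hball, hiso⟩ := exists_equiv_of_ballIso hab
  have hsupp : ∀ (c : RootedMarkedGraph Ξ Θ 1) (v : c.V),
      c.pairClass v (c.root 0) ∈ E → v ∈ c.ball R := fun c v hv =>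
    c.ball_mono hR (mem_ball_of_pairClass_mem' hE hv).1
  refine tsum_eq_of_equiv e
    (fun v hv => a.ball_mono (by omega) (hsupp a v (mem_of_indicator_ne_zero hv)))
    (fun v hv => b.ball_mono (by omega) (hsupp b v (mem_of_indicator_ne_zero hv)))
    fun v => indicator_one_congr ?_
  by_cases hv : (v : a.V) ∈ a.ball R
  · have := hloc _ _ (hiso v ⟨a.root 0, a.root_mem_ball _ 0⟩ hv (a.root_mem_ball R 0))
    rw [he] at this
    exact Iff.of_eq this.symm
  · exact iff_of_false (fun h' => hv ((hball v).1 (hsupp b _ h'))) fun h' => hv (hsupp a _ h')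

end

end GStar

/-! ### Unimodularity of local weak limits -/

section Unimodular

open RootedClass RootedMarkedGraph GStar

variable {Ξ Θ : Type*} {μ : Measure (GStar Ξ Θ)} [IsFiniteMeasure μ]

/-- `μ` is a local weak limit of the neighbourhood laws of finite graphs. -/
def IsSofic (μ : Measure (GStar Ξ Θ)) : Prop :=
  ∀ ε > 0, ∃ᶠ n : ℕ in atTop, ∃ G : MarkedGraph (Fin n) Ξ Θ,
    levyProkhorovDist G.neighborhoodLaw μ < ε

/-- Both integrands are local and bounded by N, and their integrals agree for every finite graph, so
both inequalities pass to the limit. -/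
theorem IsSofic.lintegral_sumFrom_eq (hμ : IsSofic μ) {E : Set (GStarStar Ξ Θ)} {h N R : ℕ}
    (hE : E ⊆ nearPairs Ξ Θ h N) (hloc : IsLocal R (· ∈ E)) (hR : h ≤ R) :
    ∫⁻ g, sumFrom (E.indicator 1) g ∂μ = ∫⁻ g, sumTo (E.indicator 1) g ∂μ := by
  have hF := isLocal_sumFrom hE hloc hR
  have hT := isLocal_sumTo hE hloc hR
  have key : ∀ {n : ℕ} (G : MarkedGraph (Fin n) Ξ Θ),
      ∫⁻ g, sumFrom (E.indicator 1) g ∂G.neighborhoodLaw =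
        ∫⁻ g, sumTo (E.indicator 1) g ∂G.neighborhoodLaw := fun G => by
    rw [G.lintegral_neighborhoodLaw hF.measurable, G.lintegral_neighborhoodLaw hT.measurable,
      G.sum_sumFrom_rootedClass]
  apply le_antisymm
  · have := lintegral_le_of_frequently (μ := μ) (c := 0) (c' := 0) (a := 0) (a' := 0) hF hT
      (sumFrom_indicator_le hE) (sumTo_indicator_le hE) tendsto_const_nhds tendsto_const_nhds
      fun ε hε => (hμ ε hε).mono fun n ⟨G, hG⟩ => ⟨G, hG, by simp [key G]⟩
    simpa using this
  · have := lintegral_le_of_frequently (μ := μ) (c := 0) (c' := 0) (a := 0) (a' := 0) hT hF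
      (sumTo_indicator_le hE) (sumFrom_indicator_le hE) tendsto_const_nhds tendsto_const_nhds
      fun ε hε => (hμ ε hε).mono fun n ⟨G, hG⟩ => ⟨G, hG, by simp [key G]⟩
    simpa using this

/-- The classes in the cylinder of `c` whose distinguished vertices are at distance at most the
radius of the balls coded by `c`. -/
def nearCylinder (c : BallCode Ξ Θ 2) : Set (GStarStar Ξ Θ) :=
  cylinder c ∩ nearPairs Ξ Θ c.1 c.2.1

/-- Both conditions in `nearPairs` can be read off the ball: its vertex count is that of the code,
and a distance not exceeding the radius is preserved. -/
theorem isLocal_nearCylinder (c : BallCode Ξ Θ 2) : IsLocal c.1 (· ∈ nearCylinder c) := by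
  have key : ∀ a b : RootedMarkedGraph Ξ Θ 2, a.BallIso c.1 b →
      (Quotient.mk _ a : GStarStar Ξ Θ) ∈ nearCylinder c → Quotient.mk _ b ∈ nearCylinder c := by
    intro a b hab ha
    have hb : (Quotient.mk _ b : GStarStar Ξ Θ) ∈ cylinder c :=
      (isLocal_cylinder c a b hab).mp ha.1
    refine ⟨hb, fun b' hb' => ⟨?_, (ncard_ball_of_mem_cylinder (hb' ▸ hb)).le⟩⟩
    exact dist_root_le_of_ballIso (ballIso_of_mem_cylinder ha.1 (hb' ▸ hb)) (ha.2 a rfl).1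
  exact fun a b hab => propext ⟨key a b hab, key b a hab.symm⟩

theorem exists_mem_nearCylinder (p : GStarStar Ξ Θ) : ∃ c, p ∈ nearCylinder c := by
  induction p using Quotient.inductionOn with | _ a
  obtain ⟨c, hc, ha⟩ := exists_mem_cylinder (Quotient.mk _ a)
    (a.G.graph.dist (a.root 0) (a.root 1))
  refine ⟨c, ha, fun b hb => ⟨?_, (ncard_ball_of_mem_cylinder (hb ▸ ha)).le⟩⟩
  exact dist_root_le_of_ballIso (ballIso_of_mem_cylinder ha (hb ▸ ha)) hc.ge

variable [Finite Ξ] [Finite Θ]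

/-- π-λ induction on A, starting from cylinders. Measurability is carried along because the
complement and union steps need it to subtract and sum integrals. -/
theorem IsSofic.lintegral_measureFrom_inter (hμ : IsSofic μ) (c : BallCode Ξ Θ 2)
    {A : Set (GStarStar Ξ Θ)} (hA : MeasurableSet A) :
    Measurable (fun g => measureFrom g (A ∩ nearCylinder c)) ∧
    Measurable (fun g => measureTo g (A ∩ nearCylinder c)) ∧
    ∫⁻ g, measureFrom g (A ∩ nearCylinder c) ∂μ = ∫⁻ g, measureTo g (A ∩ nearCylinder c) ∂μ := by
  have hbase : ∀ (E : Set (GStarStar Ξ Θ)) (R : ℕ), E ⊆ nearCylinder c → IsLocal R (· ∈ E) →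
      Measurable (fun g => measureFrom g E) ∧ Measurable (fun g => measureTo g E) ∧
      ∫⁻ g, measureFrom g E ∂μ = ∫⁻ g, measureTo g E ∂μ := by
    intro E R hE hloc
    have hE' := hE.trans inter_subset_right
    have hloc' := hloc.mono (le_max_left R c.1)
    simp only [measureFrom_apply hloc.isOpen.measurableSet,
      measureTo_apply hloc.isOpen.measurableSet]
    exact ⟨(isLocal_sumFrom hE' hloc' (le_max_right _ _)).measurable,
      (isLocal_sumTo hE' hloc' (le_max_right _ _)).measurable,
      hμ.lintegral_sumFrom_eq hE' hloc' (le_max_right _ _)⟩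
  have hD := (isLocal_nearCylinder c).isOpen.measurableSet
  -- Inside one near-cylinder both measures have mass at most the number of coded vertices, which
  -- makes the subtraction for complements legitimate.
  have hfrom : ∀ (g : GStar Ξ Θ) (E), E ⊆ nearCylinder c → measureFrom g E ≤ (c.2.1 : ℝ≥0) :=
    fun g E hE => (measure_mono hE).trans <| by
      rw [measureFrom_apply hD]
      exact sumFrom_indicator_le inter_subset_right g
  have hto : ∀ (g : GStar Ξ Θ) (E), E ⊆ nearCylinder c → measureTo g E ≤ (c.2.1 : ℝ≥0) :=
    fun g E hE => (measure_mono hE).trans <| by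
      rw [measureTo_apply hD]
      exact sumTo_indicator_le inter_subset_right g
  refine MeasurableSpace.induction_on_inter (C := fun A _ =>
    Measurable (fun g => measureFrom g (A ∩ nearCylinder c)) ∧
    Measurable (fun g => measureTo g (A ∩ nearCylinder c)) ∧
    ∫⁻ g, measureFrom g (A ∩ nearCylinder c) ∂μ = ∫⁻ g, measureTo g (A ∩ nearCylinder c) ∂μ)
    borel_eq_generateFrom_cylinder isPiSystem_range_cylinder (by simp) ?_ ?_ ?_ A hA
  · rintro _ ⟨c', rfl⟩
    exact hbase _ (max c'.1 c.1) inter_subset_right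
      (((isLocal_cylinder c').mono (le_max_left _ _)).comp₂
        ((isLocal_nearCylinder c).mono (le_max_right _ _)) And)
  · intro A hA ih
    obtain ⟨h1, h2, h3⟩ := ih
    obtain ⟨h1', h2', h3'⟩ := hbase _ _ Subset.rfl (isLocal_nearCylinder c)
    have hset : Aᶜ ∩ nearCylinder c = nearCylinder c \ (A ∩ nearCylinder c) := by
      ext p; simp only [mem_inter_iff, mem_compl_iff, Set.mem_sdiff]; tauto
    have hf : ∀ g, measureFrom g (Aᶜ ∩ nearCylinder c) =
        measureFrom g (nearCylinder c) - measureFrom g (A ∩ nearCylinder c) := fun g => by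
      rw [hset, measure_sdiff inter_subset_right (hA.inter hD).nullMeasurableSet
        ((hfrom g _ inter_subset_right).trans_lt ENNReal.coe_lt_top).ne]
    have ht : ∀ g, measureTo g (Aᶜ ∩ nearCylinder c) =
        measureTo g (nearCylinder c) - measureTo g (A ∩ nearCylinder c) := fun g => by
      rw [hset, measure_sdiff inter_subset_right (hA.inter hD).nullMeasurableSet
        ((hto g _ inter_subset_right).trans_lt ENNReal.coe_lt_top).ne]
    have hfin : ∫⁻ g, measureTo g (A ∩ nearCylinder c) ∂μ ≠ ∞ := by
      refine ne_top_of_le_ne_top ?_ (lintegral_mono fun g => hto g _ inter_subset_right)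
      rw [lintegral_const]
      exact ENNReal.mul_ne_top ENNReal.coe_ne_top (measure_ne_top _ _)
    simp only [hf, ht]
    refine ⟨h1'.sub h1, h2'.sub h2, ?_⟩
    rw [lintegral_sub h1 (h3 ▸ hfin)
        (Eventually.of_forall fun g => measure_mono inter_subset_right),
      lintegral_sub h2 hfin (Eventually.of_forall fun g => measure_mono inter_subset_right), h3, h3']
  · intro A hdisj hA ih
    have hf : ∀ κ : Measure (GStarStar Ξ Θ), κ ((⋃ i, A i) ∩ nearCylinder c) =
        ∑' i, κ (A i ∩ nearCylinder c) := fun κ => by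
      rw [iUnion_inter, measure_iUnion
        (fun i j hij => (hdisj hij).mono inter_subset_left inter_subset_left)
        fun i => (hA i).inter hD]
    simp only [hf]
    refine ⟨Measurable.tsum fun i => (ih i).1,
      Measurable.tsum fun i => (ih i).2.1, ?_⟩
    rw [lintegral_tsum fun i => (ih i).1.aemeasurable,
      lintegral_tsum fun i => (ih i).2.1.aemeasurable]
    exact tsum_congr fun i => (ih i).2.2

/-- The countably many near-cylinders cover the space; made disjoint, they cut A into pieces to
which the localized identity applies. -/
theorem IsSofic.lintegral_measureFrom_eq (hμ : IsSofic μ) [Nonempty (GStarStar Ξ Θ)]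
    {A : Set (GStarStar Ξ Θ)} (hA : MeasurableSet A) :
    Measurable (fun g => measureFrom g A) ∧ Measurable (fun g => measureTo g A) ∧
    ∫⁻ g, measureFrom g A ∂μ = ∫⁻ g, measureTo g A ∂μ := by
  have : Nonempty (BallCode Ξ Θ 2) :=
    ⟨(exists_mem_nearCylinder (Classical.arbitrary (GStarStar Ξ Θ))).choose⟩
  obtain ⟨c, hc⟩ := exists_surjective_nat (BallCode Ξ Θ 2)
  have hD : ∀ i, MeasurableSet (nearCylinder (c i)) := fun i =>
    (isLocal_nearCylinder (c i)).isOpen.measurableSet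
  have hD' := MeasurableSet.disjointed hD
  have hU : ⋃ i, disjointed (fun i => nearCylinder (c i)) i = univ := by
    rw [iUnion_disjointed]
    refine eq_univ_of_forall fun p => ?_
    obtain ⟨c', hp⟩ := exists_mem_nearCylinder p
    obtain ⟨i, rfl⟩ := hc c'
    exact mem_iUnion.2 ⟨i, hp⟩
  have hf : ∀ κ : Measure (GStarStar Ξ Θ), κ A =
      ∑' i, κ ((A ∩ disjointed (fun i => nearCylinder (c i)) i) ∩ nearCylinder (c i)) := fun κ => by
    have : ∀ i, (A ∩ disjointed (fun i => nearCylinder (c i)) i) ∩ nearCylinder (c i) =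
        A ∩ disjointed (fun i => nearCylinder (c i)) i := fun i =>
      inter_eq_left.2 (inter_subset_right.trans (disjointed_subset _ i))
    simp only [this]
    rw [← measure_iUnion, ← inter_iUnion, hU, inter_univ]
    · exact fun i j hij => (disjoint_disjointed (fun i => nearCylinder (c i)) hij).mono
        inter_subset_right inter_subset_right
    · exact fun i => hA.inter (hD' i)
  have ih := fun i => hμ.lintegral_measureFrom_inter (c i) (hA.inter (hD' i))
  simp only [hf]
  refine ⟨Measurable.tsum fun i => (ih i).1,
    Measurable.tsum fun i => (ih i).2.1, ?_⟩
  rw [lintegral_tsum fun i => (ih i).1.aemeasurable,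
    lintegral_tsum fun i => (ih i).2.1.aemeasurable]
  exact tsum_congr fun i => (ih i).2.2

/-- Local weak limits of finite graphs are unimodular. -/
theorem IsSofic.isUnimodular (hμ : IsSofic μ) : IsUnimodular μ := by
  intro f hf
  -- The enumeration of codes by ℕ needs a code to exist; if there is no doubly rooted graph, there
  -- is no rooted graph either.
  rcases isEmpty_or_nonempty (GStarStar Ξ Θ) with hem | hne
  · have : sumFrom f = sumTo f := by
      ext g
      exact hem.elim (g.rep.pairClass (g.rep.root 0) (g.rep.root 0))
    rw [this]
  have h1 : Measurable (measureFrom : GStar Ξ Θ → _) :=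
    Measure.measurable_of_measurable_coe _ fun A hA => (hμ.lintegral_measureFrom_eq hA).1
  have h2 : Measurable (measureTo : GStar Ξ Θ → _) :=
    Measure.measurable_of_measurable_coe _ fun A hA => (hμ.lintegral_measureFrom_eq hA).2.1
  -- Mass transport for all f says that these two mixtures coincide, and sets suffice to check that.
  have h3 : μ.bind measureFrom = μ.bind measureTo := Measure.ext fun A hA => by
    rw [Measure.bind_apply hA h1.aemeasurable, Measure.bind_apply hA h2.aemeasurable]
    exact (hμ.lintegral_measureFrom_eq hA).2.2
  have hf' := measurable_coe_nnreal_ennreal.comp hf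
  simp only [← lintegral_measureFrom hf, ← lintegral_measureTo hf]
  have h4 := Measure.lintegral_bind (m := μ) h1.aemeasurable (hf'.aemeasurable)
  have h5 := Measure.lintegral_bind (m := μ) h2.aemeasurable (hf'.aemeasurable)
  rw [h3] at h4
  exact h4.symm.trans h5

end Unimodular

/-! ### Conclusion -/

theorem mainTheorem8 {Ξ Θ : Type*} [Fintype Ξ] [LinearOrder Ξ] [Fintype Θ]
    (μ : Measure (GStar Ξ Θ)) [IsProbabilityMeasure μ]
    (hμ_pos : 0 < meanDegree μ) (hμ_fin : meanDegree μ < ∞)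
    (d : Ξ → Ξ → ℝ≥0) (hd : IsAverageDegreeVector d)
    (Q : Θ → ℝ≥0) (hQ : ∑ θ, Q θ = 1)
    (m : ℕ → Ξ → Ξ → ℕ) (u : ℕ → Θ → ℕ) (hmu : IsAdapted m u d Q)
    (h : ¬ IsUnimodular μ
      ∨ (fun x x' => (d x x' : ℝ≥0∞)) ≠ meanMarkDegree μ
      ∨ (fun θ => (Q θ : ℝ≥0∞)) ≠ rootMarkLaw μ) :
    upperBCEntropy m u μ = ⊥ := by
  by_contra hbot
  rcases h with h | h | h
  · exact h (IsSofic.isUnimodular fun ε hε =>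
      (frequently_graphsNear_nonempty hbot hε).mono fun n ⟨G, hG⟩ => ⟨G, hG.2⟩)
  · refine h (funext fun x => funext fun x' => le_antisymm ?_ ?_)
    · exact le_meanMarkDegree_of_upperBCEntropy_ne_bot hmu hbot x x'
    · exact meanMarkDegree_le_of_upperBCEntropy_ne_bot hmu hbot x x'
  · exact h (funext fun θ => (rootMarkLaw_eq_of_upperBCEntropy_ne_bot hmu hbot θ).symm)
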